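/- Let $\Sigma$ be a smooth complete fan in $\mathbb{R}^n$ with $n \ge 1$, and let $X = X_\Sigma$ be the associated smooth complete toric variety over $\mathbb{C}$. For each ray $\rho \in \Sigma(1)$ let $D_\rho$ be the corresponding torus-invariant prime divisor (the closure of the torus orbit of $\rho$), and let $[D_\rho]$ be its class in $\mathrm{Pic}(X) = \mathrm{Cl}(X)$, the group of Weil divisors modulo linear equivalence. Let $\mathrm{Eff}(X) \subseteq \mathrm{Pic}(X) \otimes_{\mathbb{Z}} \mathbb{R}$ be the convex cone generated by the classes of effective divisors. Then $X$ admits a maximal torus-invariant divisor: there is a ray $\rho_0 \in \Sigma(1)$ such that for every ray $\rho \in \Sigma(1)$, either $[D_\rho] = [D_{\rho_0}]$ in $\mathrm{Pic}(X)$, or the image of $[D_\rho] - [D_{\rho_0}]$ in $\mathrm{Pic}(X) \otimes_{\mathbb{Z}} \mathbb{R}$ does not lie in $\mathrm{Eff}(X)$. -/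

import Mathlib

open scoped TensorProduct

noncomputable section

namespace Toric

open CategoryTheory AlgebraicGeometry
open scoped AddMonoidAlgebra

/-! ### Smooth fans in `ℝⁿ`

The lattice of one-parameter subgroups is `N = ℤⁿ`, the character lattice is `M = ℤⁿ`, and the
pairing between them is the dot product. -/

/-- The real cone in `ℝⁿ` generated by a finite set of lattice vectors. -/
def cone {n : ℕ} (s : Finset (Fin n → ℤ)) : PointedCone ℝ (Fin n → ℝ) :=
  PointedCone.hull ℝ ((fun u i => (u i : ℝ)) '' (s : Set (Fin n → ℤ)))

/-- The finite set `s` of lattice vectors can be extended to a basis of `ℤⁿ`, i.e. `s` is the set of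
primitive generators of the rays of a smooth cone. -/
def IsPartOfBasis {n : ℕ} (s : Finset (Fin n → ℤ)) : Prop :=
  ∃ b : Module.Basis (Fin n) ℤ (Fin n → ℤ), (s : Set (Fin n → ℤ)) ⊆ Set.range b

/-- A smooth fan in `ℝⁿ`: a finite nonempty collection of smooth cones, closed under passing to
faces, such that two cones intersect in a common face. A smooth cone is recorded by the set `s` of
primitive generators of its rays; its faces are then the cones over the subsets of `s`. -/
structure SmoothFan (n : ℕ) where
  /-- The cones of the fan, each given by its set of primitive ray generators. -/
  cones : Finset (Finset (Fin n → ℤ))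
  /-- The trivial cone `{0}` belongs to the fan. -/
  zero_mem : ∅ ∈ cones
  /-- Every cone is smooth. -/
  smooth : ∀ s ∈ cones, IsPartOfBasis s
  /-- Every face of a cone of the fan belongs to the fan. -/
  face_mem : ∀ s ∈ cones, ∀ t ⊆ s, t ∈ cones
  /-- Two cones of the fan intersect in a common face. -/
  inter : ∀ s ∈ cones, ∀ t ∈ cones, cone s ⊓ cone t = cone (s ∩ t)

section CoordinateRings

variable {n : ℕ}

/-- The character `χᵐ`, as an element of the coordinate ring `ℂ[M]` of the torus. -/
def monomial (m : Fin n → ℤ) : ℂ[Fin n → ℤ] := AddMonoidAlgebra.single m 1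

lemma monomial_add (m m' : Fin n → ℤ) : monomial (m + m') = monomial m * monomial m' := by
  simp [monomial, AddMonoidAlgebra.single_mul_single]

lemma monomial_zero : monomial (0 : Fin n → ℤ) = 1 := rfl

/-- The ring `ℂ[σ^∨ ∩ M]`, for `σ` the cone generated by `s`: the subalgebra of `ℂ[M]` of all
linear combinations of characters `χᵐ` with `m` nonnegative on `σ`. -/
def coordRing (s : Finset (Fin n → ℤ)) : Subalgebra ℂ ℂ[Fin n → ℤ] where
  carrier := {f | ∀ m ∈ f.coeff.support, ∀ u ∈ s, 0 ≤ m ⬝ᵥ u}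
  mul_mem' := by
    classical
    intro f g hf hg m hm u hu
    obtain ⟨a, ha, b, hb, rfl⟩ :=
      Finset.mem_add.mp (AddMonoidAlgebra.support_coeff_mul_subset f g hm)
    rw [add_dotProduct]
    exact add_nonneg (hf a ha u hu) (hg b hb u hu)
  add_mem' := by
    classical
    intro f g hf hg m hm u hu
    rcases Finset.mem_union.mp (Finsupp.support_add hm) with h | h
    · exact hf m h u hu
    · exact hg m h u hu
  algebraMap_mem' := by
    intro r m hm u hu
    have : m = 0 := by
      by_contra h
      simp [AddMonoidAlgebra.coe_algebraMap, Ne.symm h] at hm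
    simp [this]

lemma mem_coordRing {s : Finset (Fin n → ℤ)} {f : ℂ[Fin n → ℤ]} :
    f ∈ coordRing s ↔ ∀ m ∈ f.coeff.support, ∀ u ∈ s, 0 ≤ m ⬝ᵥ u := Iff.rfl

lemma monomial_mem {s : Finset (Fin n → ℤ)} {m : Fin n → ℤ} (h : ∀ u ∈ s, 0 ≤ m ⬝ᵥ u) :
    monomial m ∈ coordRing s := by
  intro m' hm' u hu
  have : m' = m := by
    by_contra h'
    exact h' (by simpa [monomial] using hm')
  exact this ▸ h u hu

lemma coordRing_anti {s t : Finset (Fin n → ℤ)} (h : t ⊆ s) : coordRing s ≤ coordRing t :=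
  fun _ hf m hm u hu => hf m hm u (h hu)

/-- Values on the members of a partial lattice basis can be prescribed. -/
lemma IsPartOfBasis.exists_dual {s : Finset (Fin n → ℤ)} (hs : IsPartOfBasis s)
    (c : (Fin n → ℤ) → ℤ) : ∃ m : Fin n → ℤ, ∀ u ∈ s, m ⬝ᵥ u = c u := by
  obtain ⟨b, hb⟩ := hs
  let φ : (Fin n → ℤ) →ₗ[ℤ] ℤ := b.constr ℤ (fun j => c (b j))
  refine ⟨fun i => φ (Pi.single i 1), fun u hu => ?_⟩
  have h1 : (fun i => φ (Pi.single i 1)) ⬝ᵥ u = φ u := by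
    have h2 : u = ∑ i, u i • (Pi.single i (1 : ℤ) : Fin n → ℤ) := by
      ext j
      simp [Finset.sum_apply, Pi.single_apply]
    conv_rhs => rw [h2, map_sum]
    simp only [dotProduct, map_smul, smul_eq_mul, mul_comm]
  obtain ⟨j, rfl⟩ := hb hu
  rw [h1]
  simp [φ]

lemma monomial_pow (m : Fin n → ℤ) (k : ℕ) : monomial m ^ k = monomial (k • m) := by
  induction k with
  | zero => simp [monomial_zero]
  | succ k ih => rw [pow_succ, ih, ← monomial_add, succ_nsmul]

lemma IsPartOfBasis.isNoetherianRing {s : Finset (Fin n → ℤ)} (hs : IsPartOfBasis s) :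
    IsNoetherianRing (coordRing s) := by
  classical
  obtain ⟨b, hb⟩ := hs
  have key : ∀ j, ∃ e : Fin n → ℤ, ∀ i, e ⬝ᵥ b i = if i = j then 1 else 0 := by
    intro j
    obtain ⟨e, he⟩ := IsPartOfBasis.exists_dual (s := Finset.univ.image b)
      ⟨b, by simp⟩ (fun u => if u = b j then 1 else 0)
    refine ⟨e, fun i => ?_⟩
    rw [he (b i) (by simp)]
    simp [b.injective.eq_iff]
  choose e he using key
  have hsum : ∀ m : Fin n → ℤ, m = ∑ j, (m ⬝ᵥ b j) • e j := by
    intro m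
    have hb' : ∀ i, m ⬝ᵥ b i = (∑ j, (m ⬝ᵥ b j) • e j) ⬝ᵥ b i := by
      intro i
      simp only [sum_dotProduct, smul_dotProduct, he]
      simp
    have hall : ∀ v : Fin n → ℤ, m ⬝ᵥ v = (∑ j, (m ⬝ᵥ b j) • e j) ⬝ᵥ v := by
      intro v
      rw [← b.sum_repr v]
      rw [dotProduct_sum, dotProduct_sum]
      exact Finset.sum_congr rfl fun i _ => by rw [dotProduct_smul, dotProduct_smul, ← hb' i]
    exact dotProduct_eq _ _ hall
  let G : Finset ℂ[Fin n → ℤ] := Finset.univ.image (fun j => monomial (e j)) ∪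
    (Finset.univ.filter (fun j => b j ∉ s)).image (fun j => monomial (-e j))
  have hG : coordRing s = Algebra.adjoin ℂ (G : Set ℂ[Fin n → ℤ]) := by
    apply le_antisymm
    · intro f hf
      have hmon : ∀ m ∈ f.coeff.support, monomial m ∈ Algebra.adjoin ℂ (G : Set ℂ[Fin n → ℤ]) := by
        intro m hm
        rw [hsum m]
        have hprod : ∀ T : Finset (Fin n), monomial (∑ j ∈ T, (m ⬝ᵥ b j) • e j) ∈
            Algebra.adjoin ℂ (G : Set ℂ[Fin n → ℤ]) := by
          intro T
          induction T using Finset.induction_on with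
          | empty => simp [monomial_zero]
          | insert j T hj ih =>
            rw [Finset.sum_insert hj, monomial_add]
            refine mul_mem ?_ ih
            rcases le_or_gt 0 (m ⬝ᵥ b j) with h | h
            · obtain ⟨k, hk⟩ := Int.eq_ofNat_of_zero_le h
              rw [hk, natCast_zsmul, ← monomial_pow]
              exact pow_mem (Algebra.subset_adjoin (by simp [G])) k
            · obtain ⟨k, hk⟩ := Int.eq_ofNat_of_zero_le (neg_nonneg.mpr h.le)
              have hjs : b j ∉ s := fun hjs => absurd (hf m hm _ hjs) (not_le.mpr h)
              have : (m ⬝ᵥ b j) • e j = k • (-e j) := by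
                rw [← neg_neg (m ⬝ᵥ b j), hk, neg_smul, natCast_zsmul, smul_neg]
              rw [this, ← monomial_pow]
              refine pow_mem (Algebra.subset_adjoin ?_) k
              simp only [G, Finset.coe_union, Finset.coe_image]
              exact Or.inr ⟨j, by simp [hjs], rfl⟩
        exact hprod _
      have hf' : f = ∑ m ∈ f.coeff.support, f.coeff m • monomial m := by
        conv_lhs => rw [← AddMonoidAlgebra.sum_coeff_single f]
        simp [Finsupp.sum, monomial]
      rw [hf']
      exact sum_mem fun m hm => Subalgebra.smul_mem _ (hmon m hm) _
    · rw [Algebra.adjoin_le_iff]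
      intro x hx
      simp only [G, Finset.coe_union, Finset.coe_image] at hx
      rcases hx with ⟨j, -, rfl⟩ | ⟨j, hj, rfl⟩
      · refine monomial_mem fun u hu => ?_
        obtain ⟨i, rfl⟩ := hb hu
        rw [he]
        split_ifs <;> simp
      · refine monomial_mem fun u hu => ?_
        obtain ⟨i, rfl⟩ := hb hu
        rw [neg_dotProduct, he, if_neg]
        · simp
        · rintro rfl
          simp at hj
          exact hj hu
  have hfg : (coordRing s).FG := ⟨G, hG.symm⟩
  have : Algebra.FiniteType ℂ (coordRing s) := (coordRing s).fg_iff_finiteType.mp hfg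
  exact Algebra.FiniteType.isNoetherianRing ℂ _

/-- Passing to a face inverts a character. -/
lemma isLocalization_away {s t : Finset (Fin n → ℤ)} (h : t ⊆ s) {m : Fin n → ℤ}
    (h0 : ∀ u ∈ t, m ⬝ᵥ u = 0) (h1 : ∀ u ∈ s, u ∉ t → 0 < m ⬝ᵥ u)
    (hm : monomial m ∈ coordRing s) :
    letI := (Subalgebra.inclusion (coordRing_anti h)).toRingHom.toAlgebra
    IsLocalization.Away (⟨monomial m, hm⟩ : coordRing s) (coordRing t) := by
  let : Algebra (coordRing s) (coordRing t) :=
    (Subalgebra.inclusion (coordRing_anti h)).toRingHom.toAlgebra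
  have hval : ∀ x : coordRing s, ((algebraMap (coordRing s) (coordRing t) x : coordRing t) :
      ℂ[Fin n → ℤ]) = x := fun x => rfl
  have hneg : monomial (-m) ∈ coordRing t :=
    monomial_mem fun u hu => by simp [h0 u hu]
  refine ⟨⟨?_, ?_, ?_⟩⟩
  · rintro ⟨_, k, rfl⟩
    refine IsUnit.of_mul_eq_one (⟨monomial (-m), hneg⟩ ^ k) (Subtype.ext ?_)
    simp only [map_pow, MulMemClass.coe_mul, SubmonoidClass.coe_pow, hval]
    rw [← mul_pow, ← monomial_add, add_neg_cancel, monomial_zero, one_pow]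
    rfl
  · intro f
    obtain ⟨N, hN⟩ : ∃ N : ℕ, ∀ m' ∈ (f : ℂ[Fin n → ℤ]).coeff.support, ∀ u ∈ s,
        -(m' ⬝ᵥ u) ≤ N := by
      refine ⟨∑ m' ∈ (f : ℂ[Fin n → ℤ]).coeff.support, ∑ u ∈ s, (m' ⬝ᵥ u).natAbs, ?_⟩
      intro m' hm' u hu
      have h2 : (m' ⬝ᵥ u).natAbs ≤ ∑ u ∈ s, (m' ⬝ᵥ u).natAbs :=
        Finset.single_le_sum (f := fun u => (m' ⬝ᵥ u).natAbs) (fun _ _ => Nat.zero_le _) hu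
      have h3 : ∑ u ∈ s, (m' ⬝ᵥ u).natAbs ≤
          ∑ m' ∈ (f : ℂ[Fin n → ℤ]).coeff.support, ∑ u ∈ s, (m' ⬝ᵥ u).natAbs :=
        Finset.single_le_sum (f := fun m' => ∑ u ∈ s, (m' ⬝ᵥ u).natAbs)
          (fun _ _ => Nat.zero_le _) hm'
      omega
    have hmem : monomial (N • m) * (f : ℂ[Fin n → ℤ]) ∈ coordRing s := by
      classical
      intro m' hm' u hu
      obtain ⟨a, ha, rfl⟩ := Finset.mem_image.mp
        (AddMonoidAlgebra.support_coeff_single_mul_subset _ _ _ hm')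
      rw [add_dotProduct, smul_dotProduct, nsmul_eq_mul]
      by_cases hut : u ∈ t
      · rw [h0 u hut]
        simpa using f.2 a ha u hut
      · have := h1 u hu hut
        have := hN a ha u hu
        nlinarith
    refine ⟨(⟨_, hmem⟩, ⟨_, N, rfl⟩), Subtype.ext ?_⟩
    simp only [map_pow, MulMemClass.coe_mul, SubmonoidClass.coe_pow, hval]
    rw [monomial_pow, mul_comm]
  · intro x y hxy
    have : x = y := Subtype.ext (by rw [← hval x, hxy, hval])
    exact ⟨1, by rw [this]⟩

end CoordinateRings


lemma isOpenImmersion_of_face {n : ℕ} {s t : Finset (Fin n → ℤ)} (hs : IsPartOfBasis s)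
    (h : t ⊆ s) :
    IsOpenImmersion (Spec.map (CommRingCat.ofHom
      (Subalgebra.inclusion (coordRing_anti h)).toRingHom)) := by
  classical
  obtain ⟨m, hm⟩ := hs.exists_dual (fun u => if u ∈ t then 0 else 1)
  have h0 : ∀ u ∈ t, m ⬝ᵥ u = 0 := fun u hu => by rw [hm u (h hu), if_pos hu]
  have h1 : ∀ u ∈ s, u ∉ t → 0 < m ⬝ᵥ u := fun u hu hut => by
    rw [hm u hu, if_neg hut]; exact one_pos
  have hmem : monomial m ∈ coordRing s := monomial_mem fun u hu => by
    rw [hm u hu]; split_ifs <;> simp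
  have := isLocalization_away h h0 h1 hmem
  let : Algebra (coordRing s) (coordRing t) :=
    (Subalgebra.inclusion (coordRing_anti h)).toRingHom.toAlgebra
  exact IsOpenImmersion.of_isLocalization (⟨monomial m, hmem⟩ : coordRing s)

lemma mem_range_face_iff {n : ℕ} {s t : Finset (Fin n → ℤ)} (h : t ⊆ s) {m : Fin n → ℤ}
    (h0 : ∀ u ∈ t, m ⬝ᵥ u = 0) (h1 : ∀ u ∈ s, u ∉ t → 0 < m ⬝ᵥ u)
    (hmem : monomial m ∈ coordRing s) (x : PrimeSpectrum (coordRing s)) :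
    x ∈ Set.range (PrimeSpectrum.comap (Subalgebra.inclusion (coordRing_anti h)).toRingHom) ↔
      (⟨monomial m, hmem⟩ : coordRing s) ∉ x.asIdeal := by
  have := isLocalization_away h h0 h1 hmem
  let : Algebra (coordRing s) (coordRing t) :=
    (Subalgebra.inclusion (coordRing_anti h)).toRingHom.toAlgebra
  have h2 := PrimeSpectrum.localization_away_comap_range (coordRing t)
    (⟨monomial m, hmem⟩ : coordRing s)
  rw [← PrimeSpectrum.mem_basicOpen, ← SetLike.mem_coe, ← h2]
  rfl

/-- The face characters used to pass from `s` to a face `t`. -/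
lemma IsPartOfBasis.exists_face_character {n : ℕ} {s : Finset (Fin n → ℤ)}
    (hs : IsPartOfBasis s) (t : Finset (Fin n → ℤ)) (h : t ⊆ s) :
    ∃ m : Fin n → ℤ, (∀ u ∈ t, m ⬝ᵥ u = 0) ∧ (∀ u ∈ s, u ∉ t → 0 < m ⬝ᵥ u) ∧
      monomial m ∈ coordRing s := by
  classical
  obtain ⟨m, hm⟩ := hs.exists_dual (fun u => if u ∈ t then 0 else 1)
  refine ⟨m, fun u hu => by rw [hm u (h hu), if_pos hu], fun u hu hut => ?_,
    monomial_mem fun u hu => ?_⟩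
  · rw [hm u hu, if_neg hut]; exact one_pos
  · rw [hm u hu]; split_ifs <;> simp

namespace SmoothFan

variable {n : ℕ} (Δ : SmoothFan n)

/-- The fan is complete: its cones cover `ℝⁿ`. -/
def IsComplete : Prop := ∀ v : Fin n → ℝ, ∃ s ∈ Δ.cones, v ∈ cone s

/-- The diagram of affine toric charts `U_σ = Spec ℂ[σ^∨ ∩ M]`, indexed by the cones of the fan,
with the open immersions `U_τ ⟶ U_σ` for `τ` a face of `σ`. -/
def charts : Δ.cones ⥤ Scheme.{0} where
  obj s := Spec (.of (coordRing s.1))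
  map {_ _} f := Spec.map (CommRingCat.ofHom
    (Subalgebra.inclusion (coordRing_anti (leOfHom f))).toRingHom)
  map_id _ := Spec.map_id _
  map_comp _ _ := by rw [← Spec.map_comp]; rfl

instance {s t : Δ.cones} (f : s ⟶ t) : IsOpenImmersion (Δ.charts.map f) :=
  isOpenImmersion_of_face (Δ.smooth _ t.2) (leOfHom f)

instance : (Δ.charts ⋙ Scheme.forget).IsLocallyDirected where
  cond := by
    classical
    intro i j k fi fj xi xj hx
    let l : Δ.cones := ⟨i.1 ∩ j.1, Δ.face_mem _ i.2 _ Finset.inter_subset_left⟩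
    let gi : l ⟶ i := homOfLE (Finset.inter_subset_left : i.1 ∩ j.1 ⊆ i.1)
    let gj : l ⟶ j := homOfLE (Finset.inter_subset_right : i.1 ∩ j.1 ⊆ j.1)
    have hx' : Δ.charts.map fi xi = Δ.charts.map fj xj := hx
    have key : ∃ z : Δ.charts.obj l, Δ.charts.map (gi ≫ fi) z = Δ.charts.map fi xi := by
      obtain ⟨mi, hi0, hi1, hi⟩ :=
        (Δ.smooth _ k.2).exists_face_character i.1 (leOfHom fi)
      obtain ⟨mj, hj0, hj1, hj⟩ :=
        (Δ.smooth _ k.2).exists_face_character j.1 (leOfHom fj)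
      let y : PrimeSpectrum (coordRing k.1) := Δ.charts.map fi xi
      have hyi := (mem_range_face_iff (leOfHom fi) hi0 hi1 hi y).mp ⟨xi, rfl⟩
      have hyj := (mem_range_face_iff (leOfHom fj) hj0 hj1 hj y).mp ⟨xj, hx'.symm⟩
      have hnn : ∀ {m : Fin n → ℤ} {t : Finset (Fin n → ℤ)}, (∀ u ∈ t, m ⬝ᵥ u = 0) →
          (∀ u ∈ k.1, u ∉ t → 0 < m ⬝ᵥ u) → ∀ u ∈ k.1, 0 ≤ m ⬝ᵥ u := by
        intro m t h0 h1 u hu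
        by_cases hut : u ∈ t
        · exact (h0 u hut).ge
        · exact (h1 u hu hut).le
      have hij : monomial (mi + mj) ∈ coordRing k.1 := by
        rw [monomial_add]; exact mul_mem hi hj
      have hl0 : ∀ u ∈ l.1, (mi + mj) ⬝ᵥ u = 0 := fun u hu => by
        rw [add_dotProduct, hi0 u (Finset.mem_inter.mp hu).1, hj0 u (Finset.mem_inter.mp hu).2,
          add_zero]
      have hl1 : ∀ u ∈ k.1, u ∉ l.1 → 0 < (mi + mj) ⬝ᵥ u := fun u hu hul => by
        rw [add_dotProduct]
        by_cases hui : u ∈ i.1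
        · exact add_pos_of_nonneg_of_pos (hnn hi0 hi1 u hu)
            (hj1 u hu fun huj => hul (Finset.mem_inter.mpr ⟨hui, huj⟩))
        · exact add_pos_of_pos_of_nonneg (hi1 u hu hui) (hnn hj0 hj1 u hu)
      refine (mem_range_face_iff (leOfHom (gi ≫ fi)) hl0 hl1 hij y).mpr fun hy => ?_
      have hmul : (⟨monomial (mi + mj), hij⟩ : coordRing k.1) =
          ⟨monomial mi, hi⟩ * ⟨monomial mj, hj⟩ := Subtype.ext (monomial_add _ _)
      rw [hmul] at hy
      exact (y.2.mem_or_mem hy).elim hyi hyj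
    obtain ⟨z, hz⟩ := key
    refine ⟨l, gi, gj, z, ?_, ?_⟩
    · apply (Δ.charts.map fi).isOpenEmbedding.injective
      rw [← hz, Functor.map_comp]
      rfl
    · apply (Δ.charts.map fj).isOpenEmbedding.injective
      rw [← hx', ← hz, Subsingleton.elim (gi ≫ fi) (gj ≫ fj), Functor.map_comp]
      rfl

/-- The toric variety `X_Σ` of the fan: the gluing of the charts `U_σ` along the open subschemes
`U_τ`, for `τ` a common face. -/
def toricVariety : Scheme.{0} := Limits.colimit Δ.charts

/-- The open immersion of the chart `U_σ` into the toric variety. -/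
def chart (s : Δ.cones) : Spec (.of (coordRing s.1)) ⟶ Δ.toricVariety :=
  Limits.colimit.ι Δ.charts s

instance (s : Δ.cones) : IsOpenImmersion (Δ.chart s) :=
  inferInstanceAs (IsOpenImmersion (Limits.colimit.ι Δ.charts s))

lemma chart_jointly_surjective (x : Δ.toricVariety) : ∃ s y, Δ.chart s y = x := 
  Scheme.IsLocallyDirected.ι_jointly_surjective Δ.charts x

instance : IsIntegral Δ.toricVariety := by
  have : IrreducibleSpace Δ.toricVariety := by
    let o : Δ.cones := ⟨∅, Δ.zero_mem⟩
    let η (s : Δ.cones) : PrimeSpectrum (coordRing s.1) := ⊥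
    have hη : ∀ s, Δ.chart s (η s) = Δ.chart o (η o) := by
      intro s
      let f : o ⟶ s := homOfLE (Finset.empty_subset s.1)
      have h1 : Δ.charts.map f ≫ Δ.chart s = Δ.chart o := Limits.colimit.w Δ.charts f
      have h2 : Δ.charts.map f (η o) = η s := by
        apply PrimeSpectrum.ext
        exact Ideal.comap_bot_of_injective _ (Subalgebra.inclusion_injective _)
      rw [← h1, ← h2]
      rfl
    have huniv : (Set.univ : Set Δ.toricVariety) = closure {Δ.chart o (η o)} := by
      refine (Set.eq_univ_of_forall fun x => ?_).symm
      obtain ⟨s, y, rfl⟩ := Δ.chart_jointly_surjective x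
      rw [← specializes_iff_mem_closure, ← hη s]
      have hsp : (η s) ⤳ (y : PrimeSpectrum (coordRing s.1)) :=
        (PrimeSpectrum.le_iff_specializes _ _).mp bot_le
      exact hsp.map (Δ.chart s).continuous
    rw [irreducibleSpace_def, Set.top_eq_univ, huniv]
    exact isIrreducible_singleton.closure
  have : ∀ s : (Scheme.IsLocallyDirected.openCover Δ.charts).I₀,
      IsReduced ((Scheme.IsLocallyDirected.openCover Δ.charts).X s) := fun s =>
    inferInstanceAs (IsReduced (Spec (.of (coordRing s.1))))
  have : IsReduced Δ.toricVariety :=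
    IsReduced.of_openCover _ (Scheme.IsLocallyDirected.openCover Δ.charts)
  exact isIntegral_of_irreducibleSpace_of_isReduced _

instance : IsLocallyNoetherian Δ.toricVariety := by
  refine (isLocallyNoetherian_iff_openCover
    (Scheme.IsLocallyDirected.openCover Δ.charts)).mpr fun s => ?_
  have := (Δ.smooth _ s.2).isNoetherianRing
  exact inferInstanceAs (IsLocallyNoetherian (Spec (.of (coordRing s.1))))

/-- The rays of the fan, each given by its primitive lattice generator. -/
def Ray : Type := {u : Fin n → ℤ // {u} ∈ Δ.cones}

end SmoothFan

section BoundaryIdeal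

variable {n : ℕ}

/-- For `ρ` the ray generated by `u`, the ideal of `ℂ[ρ^∨ ∩ M]` spanned by the characters `χᵐ` with
`⟨m, u⟩ > 0`. It is the prime ideal of the closed torus orbit `O(ρ)` in the chart `U_ρ`. -/
def boundaryIdeal (u : Fin n → ℤ) : Ideal (coordRing {u}) where
  carrier := {f | ∀ m ∈ (f : ℂ[Fin n → ℤ]).coeff.support, 0 < m ⬝ᵥ u}
  zero_mem' := by simp
  add_mem' := by
    classical
    intro f g hf hg m hm
    rcases Finset.mem_union.mp (Finsupp.support_add hm) with h | h
    · exact hf m h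
    · exact hg m h
  smul_mem' := by
    classical
    intro f g hg m hm
    obtain ⟨a, ha, b, hb, rfl⟩ :=
      Finset.mem_add.mp (AddMonoidAlgebra.support_coeff_mul_subset _ _ hm)
    rw [add_dotProduct]
    exact add_pos_of_nonneg_of_pos (f.2 a ha u (Finset.mem_singleton_self u)) (hg b hb)

lemma mem_boundaryIdeal {u : Fin n → ℤ} {f : coordRing {u}} :
    f ∈ boundaryIdeal u ↔ ∀ m ∈ (f : ℂ[Fin n → ℤ]).coeff.support, 0 < m ⬝ᵥ u := Iff.rfl

/-- An element of `ℂ[ρ^∨ ∩ M]` is the sum of its part supported on `ρ^⊥` and an element of the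
boundary ideal. -/
lemma exists_decomp (u : Fin n → ℤ) (f : coordRing {u}) :
    ∃ f₀ : coordRing {u}, (∀ m ∈ (f₀ : ℂ[Fin n → ℤ]).coeff.support, m ⬝ᵥ u = 0) ∧
      f - f₀ ∈ boundaryIdeal u := by
  classical
  let g : ℂ[Fin n → ℤ] := .ofCoeff ((f : ℂ[Fin n → ℤ]).coeff.filter (fun m => m ⬝ᵥ u = 0))
  have hg : ∀ m ∈ g.coeff.support, m ⬝ᵥ u = 0 := by
    intro m hm
    simp only [g, Finsupp.support_filter, Finset.mem_filter] at hm
    exact hm.2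
  have hgm : g ∈ coordRing {u} := fun m hm v hv => by
    rw [Finset.mem_singleton.mp hv, hg m hm]
  refine ⟨⟨g, hgm⟩, hg, fun m hm => ?_⟩
  have hne : (f : ℂ[Fin n → ℤ]).coeff m - g.coeff m ≠ 0 := by
    simpa using Finsupp.mem_support_iff.mp hm
  have hgc : g.coeff m = if m ⬝ᵥ u = 0 then (f : ℂ[Fin n → ℤ]).coeff m else 0 := by
    simp [g, Finsupp.filter_apply]
  have hu : m ⬝ᵥ u ≠ 0 := by
    intro h
    rw [hgc, if_pos h, sub_self] at hne
    exact hne rfl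
  rw [hgc, if_neg hu, sub_zero] at hne
  exact lt_of_le_of_ne (f.2 m (Finsupp.mem_support_iff.mpr hne) u (Finset.mem_singleton_self u))
    (Ne.symm hu)

lemma eq_zero_of_mem_boundaryIdeal {u : Fin n → ℤ} {f : coordRing {u}}
    (h : f ∈ boundaryIdeal u) (h0 : ∀ m ∈ (f : ℂ[Fin n → ℤ]).coeff.support, m ⬝ᵥ u = 0) :
    f = 0 := by
  have : (f : ℂ[Fin n → ℤ]).coeff.support = ∅ :=
    Finset.eq_empty_of_forall_notMem fun m hm => (h m hm).ne' (h0 m hm)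
  apply Subtype.ext
  exact AddMonoidAlgebra.coeff_injective (Finsupp.support_eq_empty.mp this)

instance (u : Fin n → ℤ) : (boundaryIdeal u).IsPrime := by
  classical
  constructor
  · rw [Ideal.ne_top_iff_one]
    intro h
    have := h 0 (by
      rw [Finsupp.mem_support_iff]
      change (1 : ℂ[Fin n → ℤ]).coeff 0 ≠ 0
      simp)
    simp at this
  · intro f g hfg
    obtain ⟨f₀, hf₀, hf⟩ := exists_decomp u f
    obtain ⟨g₀, hg₀, hg⟩ := exists_decomp u g
    have h1 : f₀ * g₀ ∈ boundaryIdeal u := by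
      have : f₀ * g₀ = f * g - (f * (g - g₀) + g₀ * (f - f₀)) := by ring
      rw [this]
      exact sub_mem hfg (add_mem (Ideal.mul_mem_left _ _ hg) (Ideal.mul_mem_left _ _ hf))
    have h2 : f₀ * g₀ = 0 := eq_zero_of_mem_boundaryIdeal h1 fun m hm => by
      obtain ⟨a, ha, b, hb, rfl⟩ :=
        Finset.mem_add.mp (AddMonoidAlgebra.support_coeff_mul_subset _ _ hm)
      rw [add_dotProduct, hf₀ a ha, hg₀ b hb, add_zero]
    rcases mul_eq_zero.mp h2 with h | h
    · left; simpa [h] using hf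
    · right; simpa [h] using hg

lemma height_boundaryIdeal {u : Fin n → ℤ} (hu : IsPartOfBasis {u}) :
    (boundaryIdeal u).height = 1 := by
  obtain ⟨e, he⟩ := hu.exists_dual (fun _ => 1)
  have he : e ⬝ᵥ u = 1 := he u (Finset.mem_singleton_self u)
  have hmem : monomial e ∈ coordRing {u} := monomial_mem fun v hv => by
    rw [Finset.mem_singleton.mp hv, he]; exact zero_le_one
  have hx : (⟨monomial e, hmem⟩ : coordRing {u}) ∈ boundaryIdeal u := by
    intro m hm
    have : m = e := by
      by_contra h'
      exact h' (by simpa [monomial] using hm)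
    rw [this, he]; exact one_pos
  have := hu.isNoetherianRing
  have hspan : boundaryIdeal u = Ideal.span {⟨monomial e, hmem⟩} := by
    classical
    apply le_antisymm
    · intro f hf
      have hg : monomial (-e) * (f : ℂ[Fin n → ℤ]) ∈ coordRing {u} := by
        intro m hm v hv
        obtain ⟨a, ha, rfl⟩ := Finset.mem_image.mp
          (AddMonoidAlgebra.support_coeff_single_mul_subset _ _ _ hm)
        have := hf a ha
        rw [Finset.mem_singleton.mp hv, add_dotProduct, neg_dotProduct, he]
        omega
      refine Ideal.mem_span_singleton.mpr ⟨⟨_, hg⟩, Subtype.ext ?_⟩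
      change (f : ℂ[Fin n → ℤ]) = monomial e * (monomial (-e) * f)
      rw [← mul_assoc, ← monomial_add, add_neg_cancel, monomial_zero, one_mul]
    · exact (Ideal.span_singleton_le_iff_mem _).mpr hx
  have hprin : (boundaryIdeal u).IsPrincipal := ⟨_, hspan⟩
  apply le_antisymm
  · refine Ideal.height_le_one_of_isPrincipal_of_mem_minimalPrimes (boundaryIdeal u) _ ?_
    rw [Ideal.minimalPrimes_eq_subsingleton_self]
    rfl
  · rw [Order.one_le_iff_ne_zero, Ne, Ideal.height_eq_zero_iff_eq_bot]
    intro hbot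
    rw [hbot, Ideal.mem_bot] at hx
    have := congrArg (fun f : coordRing {u} => (f : ℂ[Fin n → ℤ]).coeff e) hx
    simp [monomial] at this

end BoundaryIdeal

section Divisors

variable (X : Scheme.{0})

/-- Prime divisors of `X`, given by their generic points: the points of codimension one. -/
def PrimeDivisor : Type := {x : X // Order.coheight x = 1}

/-- Weil divisors (on a noetherian scheme). -/
abbrev WeilDivisor : Type := PrimeDivisor X →₀ ℤ

variable [IsIntegral X] [IsLocallyNoetherian X]

/-- The subgroup of principal divisors `div f`, for `f` a nonzero rational function. -/
def principalDivisors : AddSubgroup (WeilDivisor X) where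
  carrier := {D | ∃ f : X.functionField, f ≠ 0 ∧ ∀ x, D x = Scheme.ord f x.1}
  zero_mem' := by
    refine ⟨1, one_ne_zero, fun x => ?_⟩
    have h := Scheme.ord_mul (x := x.1) (one_ne_zero (α := X.functionField)) one_ne_zero
    rw [mul_one] at h
    rw [Finsupp.zero_apply]
    omega
  add_mem' := by
    rintro D E ⟨f, hf, hD⟩ ⟨g, hg, hE⟩
    refine ⟨f * g, mul_ne_zero hf hg, fun x => ?_⟩
    rw [Finsupp.add_apply, hD, hE, Scheme.ord_mul hf hg]
  neg_mem' := by
    rintro D ⟨f, hf, hD⟩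
    refine ⟨f⁻¹, inv_ne_zero hf, fun x => ?_⟩
    have h := Scheme.ord_mul (x := x.1) (one_ne_zero (α := X.functionField)) one_ne_zero
    have h' := Scheme.ord_mul (x := x.1) hf (inv_ne_zero hf)
    rw [mul_one] at h
    rw [mul_inv_cancel₀ hf] at h'
    rw [Finsupp.neg_apply, hD]
    omega

/-- Weil divisors modulo linear equivalence. On a smooth variety this is the Picard group. -/
abbrev DivisorClassGroup : Type := WeilDivisor X ⧸ principalDivisors X

variable {X} in
/-- The class `[D]` of a divisor. -/
def WeilDivisor.toClass (D : WeilDivisor X) : DivisorClassGroup X :=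
  QuotientAddGroup.mk D

/-- The effective cone `Eff(X)`: the convex cone in `Cl(X) ⊗ ℝ` generated by the classes of effective
divisors. -/
def effectiveCone : PointedCone ℝ (ℝ ⊗[ℤ] DivisorClassGroup X) :=
  PointedCone.hull ℝ {a | ∃ D : WeilDivisor X, 0 ≤ D ∧ a = 1 ⊗ₜ D.toClass}

end Divisors

namespace SmoothFan

variable {n : ℕ} (Δ : SmoothFan n)

/-- The generic point of the closure of the torus orbit `O(ρ)`. -/
def boundaryPoint (ρ : Δ.Ray) : Δ.toricVariety :=
  Δ.chart ⟨{ρ.1}, ρ.2⟩ (⟨boundaryIdeal ρ.1, inferInstance⟩ : PrimeSpectrum (coordRing {ρ.1}))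

lemma coheight_boundaryPoint (ρ : Δ.Ray) : Order.coheight (Δ.boundaryPoint ρ) = 1 := by
  refine (coheight_eq_of_isOpenImmersion (Δ.chart ⟨{ρ.1}, ρ.2⟩)).trans ?_
  rw [← height_boundaryIdeal (Δ.smooth _ ρ.2)]
  exact (idealHeight_eq_coheight (.of (coordRing {ρ.1})) _).symm

/-- The torus-invariant prime divisor `D_ρ`, the closure of the torus orbit `O(ρ)`. -/
def toricDivisor (ρ : Δ.Ray) : WeilDivisor Δ.toricVariety :=
  Finsupp.single ⟨Δ.boundaryPoint ρ, Δ.coheight_boundaryPoint ρ⟩ 1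

end SmoothFan

end Toric

end

open scoped TensorProduct

noncomputable section

namespace Toric

open CategoryTheory AlgebraicGeometry
open scoped AddMonoidAlgebra

/-! ### Laurent polynomials: unique factorization and units. -/

section LaurentAlgebra

variable {n : ℕ}

/-! A linear form on `Cl(X)` that is positive on every `D_ρ` turns the partial order given by the
effective cone into a comparison of real numbers, and a ray of largest degree is maximal. Suppose
`[D_ρ] - [D_ρ₀]` is effective over `ℝ`. Its degree is at most zero, yet it is a nonnegative
combination of classes of positive degree, so it vanishes in `Cl(X) ⊗ ℝ`; since `Cl(X)` is torsion
free, it vanishes in `Cl(X)`.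

The degree (`exists_degree`) comes from completeness: some relation `∑ b_ρ u_ρ = 0` among the ray
generators has all `b_ρ > 0`, and then `∑ a_ρ D_ρ ↦ ∑ b_ρ a_ρ` kills the divisors of characters.
Torsion-freeness (`isTorsionFree`) holds because some cone of the fan is spanned by a lattice basis.

Both need the toric description of `Cl(X)`. The coordinate ring of the torus is factorial, so every
divisor is equivalent to an invariant one, with effectivity preserved (`exists_toClass_eq`). Its
units are scalar multiples of characters, so invariant principal divisors come from characters
(`exists_eq_of_mem_principalDivisors`). The first fact also shows that the `D_ρ` generate the
effective cone. -/

lemma eq_sum_smul_monomial (f : ℂ[Fin n → ℤ]) :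
    f = ∑ m ∈ f.coeff.support, f.coeff m • monomial m := by
  conv_lhs => rw [← AddMonoidAlgebra.sum_coeff_single f]
  simp [Finsupp.sum, monomial]

/-- The inclusion of the polynomial ring into the ring of Laurent polynomials. -/
def polyToLaurent (n : ℕ) : MvPolynomial (Fin n) ℂ →ₐ[ℂ] ℂ[Fin n → ℤ] :=
  MvPolynomial.aeval fun i => monomial (Pi.single i 1)

lemma monomial_sum {ι : Type*} (s : Finset ι) (v : ι → Fin n → ℤ) :
    monomial (∑ i ∈ s, v i) = ∏ i ∈ s, monomial (v i) := by
  classical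
  induction s using Finset.induction_on with
  | empty => simp [monomial_zero]
  | insert i s hi ih => rw [Finset.sum_insert hi, Finset.prod_insert hi, monomial_add, ih]

lemma polyToLaurent_monomial (d : Fin n →₀ ℕ) (c : ℂ) :
    polyToLaurent n (MvPolynomial.monomial d c) = c • monomial (fun i => (d i : ℤ)) := by
  have h : (fun i => (d i : ℤ)) = ∑ i, d i • (Pi.single i 1 : Fin n → ℤ) := by
    ext j
    simp [Finset.sum_apply, Pi.single_apply]
  rw [polyToLaurent, MvPolynomial.aeval_monomial, h, monomial_sum,
    Finsupp.prod_fintype _ _ (fun _ => pow_zero _), Algebra.smul_def]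
  simp only [monomial_pow]

lemma coeff_polyToLaurent (p : MvPolynomial (Fin n) ℂ) (d : Fin n →₀ ℕ) :
    (polyToLaurent n p).coeff (fun i => (d i : ℤ)) = p.coeff d := by
  classical
  induction p using MvPolynomial.induction_on' with
  | monomial e c =>
    rw [polyToLaurent_monomial, MvPolynomial.coeff_monomial]
    have : (fun i => (e i : ℤ)) = (fun i => (d i : ℤ)) ↔ e = d := by
      simp [funext_iff, Finsupp.ext_iff]
    simp [monomial, Finsupp.single_apply, this]
  | add p q hp hq => rw [map_add, MvPolynomial.coeff_add, ← hp, ← hq]; rfl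

lemma polyToLaurent_injective : Function.Injective (polyToLaurent n) := fun p q h =>
  MvPolynomial.ext _ _ fun d => by rw [← coeff_polyToLaurent, h, coeff_polyToLaurent]

lemma isUnit_monomial (m : Fin n → ℤ) : IsUnit (monomial m) :=
  IsUnit.of_mul_eq_one (monomial (-m)) (by rw [← monomial_add, add_neg_cancel, monomial_zero])

lemma exists_polyToLaurent_eq_monomial_mul (f : ℂ[Fin n → ℤ]) :
    ∃ N : ℕ, ∃ p, polyToLaurent n p = monomial (N • 1) * f := by
  obtain ⟨N, hN⟩ : ∃ N : ℕ, ∀ m ∈ f.coeff.support, ∀ i, -(m i) ≤ N := by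
    refine ⟨∑ m ∈ f.coeff.support, ∑ i, (m i).natAbs, fun m hm i => ?_⟩
    have h2 : (m i).natAbs ≤ ∑ i, (m i).natAbs :=
      Finset.single_le_sum (f := fun i => (m i).natAbs) (fun _ _ => Nat.zero_le _)
        (Finset.mem_univ i)
    have h3 : ∑ i, (m i).natAbs ≤ ∑ m ∈ f.coeff.support, ∑ i, (m i).natAbs :=
      Finset.single_le_sum (f := fun m => ∑ i, (m i).natAbs) (fun _ _ => Nat.zero_le _) hm
    omega
  -- By the choice of `N` the exponents `N + m i` are nonnegative, so `toNat` loses nothing.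
  refine ⟨N, ∑ m ∈ f.coeff.support, MvPolynomial.monomial
    (Finsupp.equivFunOnFinite.symm fun i => (N + m i).toNat) (f.coeff m), ?_⟩
  conv_rhs => rw [eq_sum_smul_monomial f]
  rw [map_sum, Finset.mul_sum]
  refine Finset.sum_congr rfl fun m hm => ?_
  rw [polyToLaurent_monomial, mul_smul_comm, ← monomial_add]
  congr 2
  ext i
  have := hN m hm i
  simp
  omega

lemma polyToLaurent_prod_X :
    polyToLaurent n (∏ i, MvPolynomial.X i) = monomial (1 : Fin n → ℤ) := by
  rw [map_prod]
  simp only [polyToLaurent, MvPolynomial.aeval_X]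
  rw [← monomial_sum]
  congr 1
  ext j
  simp [Finset.sum_apply, Pi.single_apply]

/-- Inverting the product of the variables in the polynomial ring gives the Laurent polynomials, and
localization preserves unique factorization. -/
instance : UniqueFactorizationMonoid ℂ[Fin n → ℤ] := by
  let : Algebra (MvPolynomial (Fin n) ℂ) ℂ[Fin n → ℤ] := (polyToLaurent n).toRingHom.toAlgebra
  have hmap : ∀ p, algebraMap (MvPolynomial (Fin n) ℂ) ℂ[Fin n → ℤ] p = polyToLaurent n p :=
    fun _ => rfl
  have : IsLocalization.Away (∏ i, MvPolynomial.X i : MvPolynomial (Fin n) ℂ)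
      ℂ[Fin n → ℤ] := by
    refine ⟨⟨?_, ?_, ?_⟩⟩
    · rintro ⟨_, k, rfl⟩
      simp only [hmap, map_pow, polyToLaurent_prod_X]
      exact (isUnit_monomial _).pow k
    · intro f
      obtain ⟨N, p, hp⟩ := exists_polyToLaurent_eq_monomial_mul f
      refine ⟨(p, ⟨_, N, rfl⟩), ?_⟩
      simp only [hmap, map_pow, polyToLaurent_prod_X, hp, monomial_pow, mul_comm]
    · intro x y hxy
      exact ⟨1, by rw [polyToLaurent_injective hxy]⟩
  exact UniqueFactorizationMonoid.of_isLocalization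
    (Submonoid.powers (∏ i, MvPolynomial.X i : MvPolynomial (Fin n) ℂ)) _

/-- The units of the ring of Laurent polynomials are the multiples of characters. -/
lemma exists_eq_smul_monomial_of_isUnit {f : ℂ[Fin n → ℤ]} (hf : IsUnit f) :
    ∃ c : ℂ, c ≠ 0 ∧ ∃ m, f = c • monomial m := by
  classical
  obtain ⟨g, hg⟩ := hf.exists_right_inv
  have hne : ∀ {a b : ℂ[Fin n → ℤ]}, a * b = 1 → a.coeff.support.Nonempty := by
    intro a b hab
    rw [Finsupp.support_nonempty_iff]
    intro h
    have : a = 0 := AddMonoidAlgebra.coeff_injective h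
    simp [this] at hab
  have hcard : f.coeff.support.card = 1 := by
    by_contra hc
    have h1 := (hne hg).card_pos
    have h2 := (hne ((mul_comm g f).trans hg)).card_pos
    -- If `f` had several terms, two different pairs of exponents would have sums attained only
    -- once. No cancellation occurs there, so both sums are exponents of `f * g = 1` and hence zero,
    -- contradicting uniqueness.
    obtain ⟨p, hp, q, hq, hpq, up, uq⟩ := TwoUniqueSums.uniqueAdd_of_one_lt_card
      (A := f.coeff.support) (B := g.coeff.support) (by
        have : 1 < f.coeff.support.card := by omega
        nlinarith)
    have key : ∀ r ∈ f.coeff.support ×ˢ g.coeff.support,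
        UniqueAdd f.coeff.support g.coeff.support r.1 r.2 → r.1 + r.2 = 0 := by
      intro r hr ur
      by_contra h0
      have h := AddMonoidAlgebra.coeff_mul_add_of_uniqueAdd (f := f) (g := g) ur
      rw [hg] at h
      simp only [Finset.mem_product, Finsupp.mem_support_iff] at hr
      refine mul_ne_zero hr.1 hr.2 (h.symm.trans ?_)
      rw [← monomial_zero]
      simp [monomial, Ne.symm h0]
    have h3 := up (Finset.mem_product.mp hq).1 (Finset.mem_product.mp hq).2
      ((key q hq uq).trans (key p hp up).symm)
    exact hpq (Prod.ext h3.1.symm h3.2.symm)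
  obtain ⟨m, hm⟩ := Finset.card_eq_one.mp hcard
  refine ⟨f.coeff m, Finsupp.mem_support_iff.mp (by simp [hm]), m, ?_⟩
  conv_lhs => rw [eq_sum_smul_monomial f, hm, Finset.sum_singleton]

end LaurentAlgebra

/-! ### Local rings, rational functions and orders of vanishing on an affine chart. -/

section AffineChart

variable {X : Scheme.{0}} {R : CommRingCat.{0}} (ι : Spec R ⟶ X)
  [IsOpenImmersion ι]

instance (y : Spec R) : y.asIdeal.IsPrime := y.2

/-- The local rings of an affine chart are those of the scheme. -/
def chartStalkIso (y : Spec R) : (Spec R).presheaf.stalk y ≅ X.presheaf.stalk (ι y) :=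
  (asIso (ι.stalkMap y)).symm

/-- The map from a ring to the local ring of its spectrum at a point. -/
def toSpecStalk (y : Spec R) : R ⟶ (Spec R).presheaf.stalk y :=
  (Scheme.ΓSpecIso R).inv ≫ (Spec R).presheaf.germ ⊤ y trivial

/-- The map from the coordinate ring of an affine chart to the local ring at a point. -/
def chartToStalk (y : Spec R) : R ⟶ X.presheaf.stalk (ι y) :=
  toSpecStalk y ≫ (chartStalkIso ι y).hom

lemma SpecMap_chartToStalk (y : Spec R) :
    Spec.map (chartToStalk ι y) ≫ ι = X.fromSpecStalk (ι y) := by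
  have h : Spec.map (toSpecStalk y) ≫ ι =
      Spec.map (chartStalkIso ι y).inv ≫ X.fromSpecStalk (ι y) :=
    (congrArg (· ≫ ι) (Spec.fromSpecStalk_eq R y)).symm.trans
      (Scheme.SpecMap_stalkMap_fromSpecStalk ι).symm
  rw [chartToStalk, Spec.map_comp, Category.assoc, h, ← Category.assoc, ← Spec.map_comp,
    Iso.inv_hom_id, Spec.map_id, Category.id_comp]

lemma isLocalization_chartToStalk (y : Spec R) :
    @IsLocalization R _ y.asIdeal.primeCompl (X.presheaf.stalk (ι y)) _
      (chartToStalk ι y).hom.toAlgebra := by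
  let : Algebra R (X.presheaf.stalk (ι y)) := (chartToStalk ι y).hom.toAlgebra
  let : Algebra R ((Spec R).presheaf.stalk y) := (toSpecStalk y).hom.toAlgebra
  have : IsLocalization y.asIdeal.primeCompl ((Spec R).presheaf.stalk y) :=
    StructureSheaf.IsLocalization.to_stalk R y
  exact (IsLocalization.isLocalization_iff_of_ringEquiv y.asIdeal.primeCompl
    (chartStalkIso ι y).commRingCatIsoToRingEquiv).mp this

lemma coheight_chart (y : Spec R) : Order.coheight (ι y) = y.asIdeal.height :=
  (coheight_eq_of_isOpenImmersion ι).trans (idealHeight_eq_coheight R y).symm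

variable [IsIntegral X]

/-- The generic point specializes to every point of the chart, and open sets are stable under
generization. -/
lemma range_fromSpecStalk_subset (hR : Nonempty (Spec R)) :
    Set.range (X.fromSpecStalk (genericPoint X)) ⊆ Set.range ι := by
  rw [Scheme.range_fromSpecStalk]
  intro y (hy : y ⤳ genericPoint X)
  obtain ⟨z⟩ := hR
  exact (hy.trans ((genericPoint_spec X).specializes trivial : genericPoint X ⤳ ι z)).mem_open
    ι.isOpenEmbedding.isOpen_range ⟨z, rfl⟩

/-- The map from the coordinate ring of a nonempty affine chart to the function field. -/
def chartToFunctionField (hR : Nonempty (Spec R)) : R ⟶ X.functionField :=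
  Spec.preimage (IsOpenImmersion.lift ι (X.fromSpecStalk (genericPoint X))
    (range_fromSpecStalk_subset ι hR))

lemma SpecMap_chartToFunctionField (hR : Nonempty (Spec R)) :
    Spec.map (chartToFunctionField ι hR) ≫ ι = X.fromSpecStalk (genericPoint X) := by
  rw [chartToFunctionField, Spec.map_preimage, IsOpenImmersion.lift_fac]

/-- Open immersions are monomorphisms. This uniqueness makes the maps obtained through stalks and
through smaller charts agree. -/
lemma eq_chartToFunctionField (hR : Nonempty (Spec R)) {φ : R ⟶ X.functionField}
    (h : Spec.map φ ≫ ι = X.fromSpecStalk (genericPoint X)) : φ = chartToFunctionField ι hR :=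
  Spec.map_injective <| (cancel_mono ι).mp <| h.trans (SpecMap_chartToFunctionField ι hR).symm

lemma algebraMap_chartToStalk (hR : Nonempty (Spec R)) (y : Spec R) (f : R) :
    algebraMap (X.presheaf.stalk (ι y)) X.functionField (chartToStalk ι y f) =
      chartToFunctionField ι hR f := by
  rw [← eq_chartToFunctionField ι hR (φ := chartToStalk ι y ≫
    X.presheaf.stalkSpecializes ((genericPoint_spec X).specializes trivial))]
  · rfl
  · rw [Spec.map_comp, Category.assoc, SpecMap_chartToStalk,
      Scheme.SpecMap_stalkSpecializes_fromSpecStalk]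

lemma chartToFunctionField_ne_zero (hR : Nonempty (Spec R)) {y : Spec R} {f : R}
    (hf : f ∉ y.asIdeal) : chartToFunctionField ι hR f ≠ 0 := by
  let : Algebra R (X.presheaf.stalk (ι y)) := (chartToStalk ι y).hom.toAlgebra
  have hu := (isLocalization_chartToStalk ι y).map_units _ (⟨f, hf⟩ : y.asIdeal.primeCompl)
  rw [← algebraMap_chartToStalk ι hR y]
  exact (hu.map (algebraMap (X.presheaf.stalk (ι y)) X.functionField)).ne_zero

/-- The function field is the fraction field of any stalk, and a stalk on the chart is a
localization of `R`; the two layers of fractions are merged. -/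
lemma exists_eq_chartToFunctionField_div (hR : Nonempty (Spec R)) (z : X.functionField) :
    ∃ a b : R, chartToFunctionField ι hR b ≠ 0 ∧
      z = chartToFunctionField ι hR a / chartToFunctionField ι hR b := by
  obtain ⟨y⟩ := id hR
  have key : ∀ w : X.presheaf.stalk (ι y), ∃ a b : R, chartToFunctionField ι hR b ≠ 0 ∧
      algebraMap _ X.functionField w =
        chartToFunctionField ι hR a / chartToFunctionField ι hR b := by
    intro w
    let : Algebra R (X.presheaf.stalk (ι y)) := (chartToStalk ι y).hom.toAlgebra
    obtain ⟨⟨a, b⟩, hab⟩ := (isLocalization_chartToStalk ι y).surj _ w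
    have hb := chartToFunctionField_ne_zero ι hR b.2
    refine ⟨a, b, hb, (eq_div_iff hb).mpr ?_⟩
    rw [← algebraMap_chartToStalk ι hR y, ← algebraMap_chartToStalk ι hR y, ← map_mul]
    exact congrArg _ hab
  obtain ⟨w, v, hv, rfl⟩ := IsFractionRing.div_surjective (A := X.presheaf.stalk (ι y)) z
  obtain ⟨a, b, hb, hw⟩ := key w
  obtain ⟨c, d, hd, hv'⟩ := key v
  have hc : chartToFunctionField ι hR c ≠ 0 := by
    intro h
    rw [h, zero_div] at hv'
    exact nonZeroDivisors.ne_zero hv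
      (IsFractionRing.injective (X.presheaf.stalk (ι y)) X.functionField
        (hv'.trans (map_zero _).symm))
  refine ⟨a * d, b * c, by simp [hb, hc], ?_⟩
  rw [hw, hv', map_mul, map_mul, div_div_div_eq]

variable [IsLocallyNoetherian X]

lemma ord_of_notMem (hR : Nonempty (Spec R)) {y : Spec R} {f : R} (hf : f ∉ y.asIdeal) :
    Scheme.ord (chartToFunctionField ι hR f) (ι y) = 0 := by
  -- Away from codimension one the order takes the default value zero.
  by_cases! hy : Order.coheight (ι y) ≠ 1
  · exact Scheme.ord_eq_zero_of_coheight_neq_one hy _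
  have : Ring.KrullDimLE 1 (X.presheaf.stalk (ι y)) := krullDimLE_of_coheight_le hy.le
  let : Algebra R (X.presheaf.stalk (ι y)) := (chartToStalk ι y).hom.toAlgebra
  have hu : IsUnit (chartToStalk ι y f) :=
    (isLocalization_chartToStalk ι y).map_units _ (⟨f, hf⟩ : y.asIdeal.primeCompl)
  have h1 := Ring.ordFrac_of_isUnit (K := X.functionField) hu
  rw [algebraMap_chartToStalk ι hR] at h1
  have h0 := chartToFunctionField_ne_zero ι hR hf
  exact (Scheme.ord_eq_iff hy h0).mpr h1

lemma ord_chart_nonneg (hR : Nonempty (Spec R)) (y : Spec R) (f : R) :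
    0 ≤ Scheme.ord (chartToFunctionField ι hR f) (ι y) := by
  by_cases! hy : Order.coheight (ι y) ≠ 1
  · exact (Scheme.ord_eq_zero_of_coheight_neq_one hy _).ge
  by_cases h0 : chartToFunctionField ι hR f = 0
  · rw [h0, Scheme.ord_zero]
    rfl
  have : Ring.KrullDimLE 1 (X.presheaf.stalk (ι y)) := krullDimLE_of_coheight_le hy.le
  have hne : chartToStalk ι y f ≠ 0 := by
    intro h
    apply h0
    rw [← algebraMap_chartToStalk ι hR y, h, map_zero]
  rw [Scheme.le_ord_iff hy h0, ← algebraMap_chartToStalk ι hR y]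
  exact Ring.ordFrac_ge_one_of_ne_zero hne

lemma ord_eq_one_of_asIdeal_eq_span (hR : Nonempty (Spec R)) {y : Spec R}
    (hy : Order.coheight (ι y) = 1) {f : R} (hf : y.asIdeal = Ideal.span {f})
    (h0 : chartToFunctionField ι hR f ≠ 0) :
    Scheme.ord (chartToFunctionField ι hR f) (ι y) = 1 := by
  have : Ring.KrullDimLE 1 (X.presheaf.stalk (ι y)) := krullDimLE_of_coheight_le hy.le
  let : Algebra R (X.presheaf.stalk (ι y)) := (chartToStalk ι y).hom.toAlgebra
  have : IsLocalization.AtPrime (X.presheaf.stalk (ι y)) y.asIdeal :=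
    isLocalization_chartToStalk ι y
  have hmax : Ideal.span {chartToStalk ι y f} =
      IsLocalRing.maximalIdeal (X.presheaf.stalk (ι y)) := by
    rw [← IsLocalization.AtPrime.map_eq_maximalIdeal y.asIdeal, hf, Ideal.map_span,
      Set.image_singleton]
    rfl
  have hne : chartToStalk ι y f ≠ 0 := by
    intro h
    apply h0
    rw [← algebraMap_chartToStalk ι hR y, h, map_zero]
  -- The order is the length of the quotient by `f`, here the residue field.
  have hord : Ring.ord (X.presheaf.stalk (ι y)) (chartToStalk ι y f) = (1 : ℕ) := by
    rw [Ring.ord, hmax, Nat.cast_one, Module.length_eq_one_iff, isSimpleModule_iff_isCoatom]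
    exact (IsLocalRing.maximalIdeal.isMaximal _).out
  rw [Scheme.ord_eq_iff hy h0, ← algebraMap_chartToStalk ι hR y]
  exact (Ring.ordFrac_eq_ord _ hne).trans
    (Ring.ordMonoidWithZeroHom_eq_coe _ (mem_nonZeroDivisors_of_ne_zero hne) hord)

end AffineChart

/-! ### Coordinate rings of toric charts. -/

section CoordRing

variable {n : ℕ}

lemma coeff_monomial_self (m : Fin n → ℤ) : (monomial m).coeff m = 1 := by
  simp [monomial]

lemma monomial_ne_zero (m : Fin n → ℤ) : monomial m ≠ 0 := fun h => by
  have := coeff_monomial_self m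
  simp [h] at this

lemma coeff_monomial_mul (m a : Fin n → ℤ) (f : ℂ[Fin n → ℤ]) :
    (monomial m * f).coeff (m + a) = f.coeff a := by
  simp [monomial]

lemma coordRing_empty (f : ℂ[Fin n → ℤ]) : f ∈ coordRing (∅ : Finset (Fin n → ℤ)) :=
  fun _ _ _ hu => absurd hu (Finset.notMem_empty _)

/-- The coordinate ring of the torus is the ring of Laurent polynomials. -/
def torusEquiv (n : ℕ) : coordRing (∅ : Finset (Fin n → ℤ)) ≃+* ℂ[Fin n → ℤ] where
  toFun f := f
  invFun f := ⟨f, coordRing_empty f⟩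
  left_inv _ := rfl
  right_inv _ := rfl
  map_mul' _ _ := rfl
  map_add' _ _ := rfl

instance : UniqueFactorizationMonoid (coordRing (∅ : Finset (Fin n → ℤ))) :=
  (torusEquiv n).symm.toMulEquiv.uniqueFactorizationMonoid inferInstance

/-- If `u ∈ s` and `e` is dual to `u` with respect to `s`, then the prime ideal of the divisor of
`u` in the chart of `s` is generated by the character of `e`. -/
lemma comap_boundaryIdeal_eq_span {s : Finset (Fin n → ℤ)} {u : Fin n → ℤ} (hu : u ∈ s)
    {e : Fin n → ℤ} (h1 : e ⬝ᵥ u = 1) (h0 : ∀ v ∈ s, v ≠ u → e ⬝ᵥ v = 0)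
    (he : monomial e ∈ coordRing s) :
    (boundaryIdeal u).comap (Subalgebra.inclusion
      (coordRing_anti (Finset.singleton_subset_iff.mpr hu))).toRingHom =
      Ideal.span {(⟨monomial e, he⟩ : coordRing s)} := by
  classical
  apply le_antisymm
  · intro f hf
    -- Dividing by the character of `e` lowers the pairing with `u`, positive on the support of `f`,
    -- by one and leaves the other pairings unchanged.
    have hg : monomial (-e) * (f : ℂ[Fin n → ℤ]) ∈ coordRing s := by
      intro m hm v hv
      obtain ⟨a, ha, rfl⟩ := Finset.mem_image.mp
        (AddMonoidAlgebra.support_coeff_single_mul_subset _ _ _ hm)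
      have hau : 0 < a ⬝ᵥ u := hf a ha
      have hav := f.2 a ha v hv
      rw [add_dotProduct, neg_dotProduct]
      by_cases hvu : v = u
      · rw [hvu, h1]
        omega
      · rw [h0 v hv hvu]
        omega
    refine Ideal.mem_span_singleton.mpr ⟨⟨_, hg⟩, Subtype.ext ?_⟩
    change (f : ℂ[Fin n → ℤ]) = monomial e * (monomial (-e) * f)
    rw [← mul_assoc, ← monomial_add, add_neg_cancel, monomial_zero, one_mul]
  · refine (Ideal.span_singleton_le_iff_mem _).mpr fun m hm => ?_
    have : m = e := by
      by_contra h'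
      exact h' (by simpa [monomial] using hm)
    rw [this, h1]
    exact one_pos

end CoordRing

/-! ### Orders of Laurent polynomials and the points of codimension one. -/

namespace SmoothFan

variable {n : ℕ} (Δ : SmoothFan n)

lemma nonempty_chart (s : Finset (Fin n → ℤ)) : Nonempty (Spec (.of (coordRing s))) :=
  ⟨(⊥ : PrimeSpectrum (coordRing s))⟩

/-- The cone of the fan defining the torus chart. -/
def torusCone : Δ.cones := ⟨∅, Δ.zero_mem⟩

/-- Laurent polynomials as rational functions on the toric variety. -/
def ratFun : ℂ[Fin n → ℤ] →+* Δ.toricVariety.functionField :=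
  (chartToFunctionField (Δ.chart Δ.torusCone) (nonempty_chart _)).hom.comp
    (torusEquiv n).symm.toRingHom

/-- Every chart contains the torus chart, so the single map `ratFun` computes rational functions on
all of them. -/
lemma chartToFunctionField_chart (s : Δ.cones) (f : coordRing s.1) :
    chartToFunctionField (Δ.chart s) (nonempty_chart _) f = Δ.ratFun f := by
  let i : Δ.torusCone ⟶ s := homOfLE (Finset.empty_subset s.1)
  have hw : Δ.charts.map i ≫ Δ.chart s = Δ.chart Δ.torusCone := Limits.colimit.w Δ.charts i
  have h : CommRingCat.ofHom (Subalgebra.inclusion (coordRing_anti (leOfHom i))).toRingHom ≫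
      chartToFunctionField (Δ.chart Δ.torusCone) (nonempty_chart _) =
        chartToFunctionField (Δ.chart s) (nonempty_chart _) := by
    apply eq_chartToFunctionField
    rw [Spec.map_comp, Category.assoc, ← SpecMap_chartToFunctionField (Δ.chart Δ.torusCone)
      (nonempty_chart _)]
    exact congrArg _ hw
  rw [← h]
  rfl

lemma ratFun_ne_zero {f : ℂ[Fin n → ℤ]} (hf : f ≠ 0) : Δ.ratFun f ≠ 0 :=
  chartToFunctionField_ne_zero (Δ.chart Δ.torusCone) (nonempty_chart _)
    (y := (⊥ : PrimeSpectrum (coordRing (∅ : Finset (Fin n → ℤ)))))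
    (f := (⟨f, coordRing_empty f⟩ : coordRing (∅ : Finset (Fin n → ℤ))))
    fun h => hf (congrArg Subtype.val (Ideal.mem_bot.mp h))

lemma exists_eq_ratFun_div (z : Δ.toricVariety.functionField) :
    ∃ a b : ℂ[Fin n → ℤ], b ≠ 0 ∧ z = Δ.ratFun a / Δ.ratFun b := by
  obtain ⟨a, b, hb, h⟩ := exists_eq_chartToFunctionField_div (Δ.chart Δ.torusCone)
    (nonempty_chart _) z
  rw [chartToFunctionField_chart Δ Δ.torusCone b] at hb
  refine ⟨(a : coordRing (∅ : Finset (Fin n → ℤ))), (b : coordRing (∅ : Finset (Fin n → ℤ))),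
    fun h0 => hb (by rw [h0, map_zero]), h⟩

/-- The order of vanishing of a Laurent polynomial at a point. -/
def laurentOrd (x : Δ.toricVariety) (f : ℂ[Fin n → ℤ]) : ℤ := Scheme.ord (Δ.ratFun f) x

lemma laurentOrd_mul (x : Δ.toricVariety) {f g : ℂ[Fin n → ℤ]} (hf : f ≠ 0) (hg : g ≠ 0) :
    Δ.laurentOrd x (f * g) = Δ.laurentOrd x f + Δ.laurentOrd x g := by
  rw [laurentOrd, map_mul, Scheme.ord_mul (Δ.ratFun_ne_zero hf) (Δ.ratFun_ne_zero hg)]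
  rfl

lemma laurentOrd_chart_of_notMem (s : Δ.cones) {y : PrimeSpectrum (coordRing s.1)}
    {f : coordRing s.1} (hf : f ∉ y.asIdeal) : Δ.laurentOrd (Δ.chart s y) f = 0 := by
  rw [laurentOrd, ← chartToFunctionField_chart]
  exact ord_of_notMem (Δ.chart s) (nonempty_chart _) hf

lemma laurentOrd_chart_of_eq_span (s : Δ.cones) {y : PrimeSpectrum (coordRing s.1)}
    (hy : Order.coheight (Δ.chart s y) = 1) {f : coordRing s.1}
    (hf : y.asIdeal = Ideal.span {f}) (h0 : (f : ℂ[Fin n → ℤ]) ≠ 0) :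
    Δ.laurentOrd (Δ.chart s y) f = 1 := by
  rw [laurentOrd, ← chartToFunctionField_chart]
  exact ord_eq_one_of_asIdeal_eq_span (Δ.chart s) (nonempty_chart _) hy hf
    (by rw [chartToFunctionField_chart]; exact Δ.ratFun_ne_zero h0)

/-- The order of vanishing of characters, as a homomorphism. -/
def monomialOrd (x : Δ.toricVariety) : (Fin n → ℤ) →+ ℤ :=
  AddMonoidHom.mk' (fun m => Δ.laurentOrd x (monomial m)) fun m m' => by
    rw [monomial_add, laurentOrd_mul _ _ (monomial_ne_zero _) (monomial_ne_zero _)]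

lemma laurentOrd_boundaryPoint_of_notMem (ρ : Δ.Ray) {f : coordRing {ρ.1}}
    (hf : f ∉ boundaryIdeal ρ.1) : Δ.laurentOrd (Δ.boundaryPoint ρ) f = 0 :=
  Δ.laurentOrd_chart_of_notMem ⟨{ρ.1}, ρ.2⟩ hf

/-- The order of vanishing of a character along a torus-invariant divisor. -/
lemma laurentOrd_monomial (ρ : Δ.Ray) (m : Fin n → ℤ) :
    Δ.laurentOrd (Δ.boundaryPoint ρ) (monomial m) = m ⬝ᵥ ρ.1 := by
  obtain ⟨e, he⟩ := (Δ.smooth _ ρ.2).exists_dual (fun _ => 1)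
  have he : e ⬝ᵥ ρ.1 = 1 := he ρ.1 (Finset.mem_singleton_self _)
  have hmem : ∀ {a : Fin n → ℤ}, 0 ≤ a ⬝ᵥ ρ.1 → monomial a ∈ coordRing {ρ.1} := by
    intro a ha
    exact monomial_mem fun v hv => by rwa [Finset.mem_singleton.mp hv]
  -- The character of `e` generates the prime of `D_ρ`. What remains of `m` after removing its
  -- multiple of `e` is orthogonal to the ray, so its character lies outside that prime.
  have h1 : Δ.monomialOrd (Δ.boundaryPoint ρ) e = 1 := by
    refine Δ.laurentOrd_chart_of_eq_span ⟨{ρ.1}, ρ.2⟩ (Δ.coheight_boundaryPoint ρ)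
      (f := ⟨monomial e, hmem (by rw [he]; exact zero_le_one)⟩) ?_ (monomial_ne_zero e)
    rw [← comap_boundaryIdeal_eq_span (Finset.mem_singleton_self _) he
      (fun v hv hvu => absurd (Finset.mem_singleton.mp hv) hvu)]
    rfl
  have h0 : Δ.monomialOrd (Δ.boundaryPoint ρ) (m - (m ⬝ᵥ ρ.1) • e) = 0 := by
    have hz : (m - (m ⬝ᵥ ρ.1) • e) ⬝ᵥ ρ.1 = 0 := by
      rw [sub_dotProduct, smul_dotProduct, he, smul_eq_mul, mul_one, sub_self]
    refine Δ.laurentOrd_boundaryPoint_of_notMem ρ (f := ⟨monomial _, hmem hz.ge⟩) fun h => ?_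
    have := h _ (Finsupp.mem_support_iff.mpr (by rw [coeff_monomial_self]; exact one_ne_zero))
    omega
  rw [map_sub, map_zsmul, h1, smul_eq_mul, mul_one, sub_eq_zero] at h0
  exact h0

/-- The order along `D_ρ` is the minimum of the pairing over the support: dividing `f` by a
minimizing character leaves a function on the chart that does not vanish identically on `D_ρ`. -/
lemma laurentOrd_le (ρ : Δ.Ray) {f : ℂ[Fin n → ℤ]} {m : Fin n → ℤ} (hm : m ∈ f.coeff.support) :
    Δ.laurentOrd (Δ.boundaryPoint ρ) f ≤ m ⬝ᵥ ρ.1 := by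
  classical
  obtain ⟨a, ha, hmin⟩ := f.coeff.support.exists_min_image (fun a => a ⬝ᵥ ρ.1) ⟨m, hm⟩
  have hg : monomial (-a) * f ∈ coordRing {ρ.1} := by
    intro b hb v hv
    obtain ⟨c, hc, rfl⟩ := Finset.mem_image.mp
      (AddMonoidAlgebra.support_coeff_single_mul_subset _ _ _ hb)
    rw [Finset.mem_singleton.mp hv, add_dotProduct, neg_dotProduct]
    have := hmin c hc
    omega
  have hg0 : Δ.laurentOrd (Δ.boundaryPoint ρ) (monomial (-a) * f) = 0 := by
    refine Δ.laurentOrd_boundaryPoint_of_notMem ρ (f := ⟨_, hg⟩) fun h => ?_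
    have := h (-a + a) (by
      rw [Finsupp.mem_support_iff, coeff_monomial_mul]
      exact Finsupp.mem_support_iff.mp ha)
    simp at this
  have hf : f ≠ 0 := by
    rintro rfl
    simp at hm
  rw [laurentOrd_mul _ _ (monomial_ne_zero _) hf, laurentOrd_monomial, neg_dotProduct] at hg0
  have := hmin m hm
  omega

/-- The point `x` of the toric variety lies on the torus. -/
def IsTorusPoint (x : Δ.toricVariety) : Prop :=
  ∃ y : PrimeSpectrum (coordRing (∅ : Finset (Fin n → ℤ))), Δ.chart Δ.torusCone y = x

lemma laurentOrd_nonneg {x : Δ.toricVariety} (hx : Δ.IsTorusPoint x) (f : ℂ[Fin n → ℤ]) :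
    0 ≤ Δ.laurentOrd x f := by
  obtain ⟨y, rfl⟩ := hx
  exact ord_chart_nonneg (Δ.chart Δ.torusCone) (nonempty_chart _) y
    (⟨f, coordRing_empty f⟩ : coordRing (∅ : Finset (Fin n → ℤ)))

lemma laurentOrd_monomial_of_isTorusPoint {x : Δ.toricVariety} (hx : Δ.IsTorusPoint x)
    (m : Fin n → ℤ) : Δ.laurentOrd x (monomial m) = 0 := by
  obtain ⟨y, rfl⟩ := hx
  have hu : IsUnit (⟨monomial m, coordRing_empty _⟩ : coordRing (∅ : Finset (Fin n → ℤ))) :=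
    (isUnit_monomial m).map (torusEquiv n).symm
  exact Δ.laurentOrd_chart_of_notMem Δ.torusCone (f := ⟨monomial m, coordRing_empty _⟩)
    fun h => y.2.ne_top (Ideal.eq_top_of_isUnit_mem _ h hu)

/-- Characters are units on the torus, but one of them has order one along `D_ρ`. -/
lemma not_isTorusPoint_boundaryPoint (ρ : Δ.Ray) : ¬ Δ.IsTorusPoint (Δ.boundaryPoint ρ) := by
  intro h
  obtain ⟨e, he⟩ := (Δ.smooth _ ρ.2).exists_dual (fun _ => 1)
  have := Δ.laurentOrd_monomial_of_isTorusPoint h e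
  rw [laurentOrd_monomial, he ρ.1 (Finset.mem_singleton_self _)] at this
  exact one_ne_zero this

lemma boundaryPoint_injective : Function.Injective Δ.boundaryPoint := by
  intro ρ ρ' h
  refine Subtype.ext (funext fun i => ?_)
  have := Δ.laurentOrd_monomial ρ (Pi.single i 1)
  rw [h, laurentOrd_monomial] at this
  simpa using this.symm

/-- A point of codimension one lies on the torus or is the generic point of a torus-invariant
divisor. -/
lemma isTorusPoint_or_eq_boundaryPoint {x : Δ.toricVariety} (hx : Order.coheight x = 1) :
    Δ.IsTorusPoint x ∨ ∃ ρ, x = Δ.boundaryPoint ρ := by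
  classical
  obtain ⟨s, y, rfl⟩ := Δ.chart_jointly_surjective x
  change PrimeSpectrum (coordRing s.1) at y
  have hy : y.asIdeal.height = 1 := (coheight_chart (Δ.chart s) y).symm.trans hx
  have hd : ∀ u, ∃ e : Fin n → ℤ, ∀ v ∈ s.1, e ⬝ᵥ v = if v = u then 1 else 0 := fun u =>
    (Δ.smooth _ s.2).exists_dual _
  choose e he using hd
  have hmem : ∀ u, monomial (e u) ∈ coordRing s.1 := fun u => monomial_mem fun v hv => by
    rw [he u v hv]
    split_ifs <;> simp
  -- If a dual character lies in the height-one prime `y`, it is a prime element and generates `y`.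
  -- Otherwise neither does the product of these characters, whose nonvanishing locus in the chart
  -- is the torus.
  by_cases hE : ∃ u ∈ s.1, (⟨monomial (e u), hmem u⟩ : coordRing s.1) ∈ y.asIdeal
  · right
    obtain ⟨u, hu, huy⟩ := hE
    have hus : ({u} : Finset (Fin n → ℤ)) ⊆ s.1 := Finset.singleton_subset_iff.mpr hu
    let ρ : Δ.Ray := ⟨u, Δ.face_mem _ s.2 _ hus⟩
    have hspan := comap_boundaryIdeal_eq_span hu ((he u u hu).trans (if_pos rfl))
      (fun v hv hvu => (he u v hv).trans (if_neg hvu)) (hmem u)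
    have hne : (⟨monomial (e u), hmem u⟩ : coordRing s.1) ≠ 0 := fun h =>
      monomial_ne_zero (e u) (congrArg Subtype.val h)
    have hprime : Prime (⟨monomial (e u), hmem u⟩ : coordRing s.1) := by
      rw [← Ideal.span_singleton_prime hne, ← hspan]
      infer_instance
    have hyspan := Ideal.eq_span_singleton_of_height_eq_one hy huy hprime
    refine ⟨ρ, ?_⟩
    let i : (⟨{u}, ρ.2⟩ : Δ.cones) ⟶ s := homOfLE hus
    have hw : Δ.charts.map i ≫ Δ.chart s = Δ.chart ⟨{u}, ρ.2⟩ := Limits.colimit.w Δ.charts i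
    have hyi : y = Δ.charts.map i (⟨boundaryIdeal u, inferInstance⟩ :
        PrimeSpectrum (coordRing {u})) :=
      PrimeSpectrum.ext (hyspan.trans hspan.symm)
    rw [hyi, boundaryPoint, ← hw]
    rfl
  · left
    push Not at hE
    let E (u : Fin n → ℤ) : coordRing s.1 := ⟨monomial (e u), hmem u⟩
    have hprod : ∏ u ∈ s.1, E u ∉ y.asIdeal := fun h => by
      obtain ⟨u, hu, hmu⟩ := (y.2.prod_mem_iff).mp h
      exact hE u hu hmu
    have hval : ((∏ u ∈ s.1, E u : coordRing s.1) : ℂ[Fin n → ℤ]) =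
        monomial (∑ u ∈ s.1, e u) := by
      rw [monomial_sum, ← Subalgebra.coe_val, map_prod]
      rfl
    have hm : monomial (∑ u ∈ s.1, e u) ∈ coordRing s.1 := hval ▸ (∏ u ∈ s.1, E u).2
    have hrange := (mem_range_face_iff (Finset.empty_subset s.1) (m := ∑ u ∈ s.1, e u)
      (fun u hu => absurd hu (Finset.notMem_empty u)) (fun v hv _ => by
        rw [sum_dotProduct, Finset.sum_congr rfl fun u _ => he u v hv]
        simp [hv]) hm y).mpr (by
          convert hprod using 2
          exact Subtype.ext hval.symm)
    obtain ⟨z, hz⟩ := hrange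
    let i : Δ.torusCone ⟶ s := homOfLE (Finset.empty_subset s.1)
    have hw : Δ.charts.map i ≫ Δ.chart s = Δ.chart Δ.torusCone := Limits.colimit.w Δ.charts i
    refine ⟨z, ?_⟩
    rw [← hw, ← hz]
    rfl

end SmoothFan

/-! ### The class group in terms of torus-invariant divisors. -/

namespace SmoothFan

variable {n : ℕ} (Δ : SmoothFan n)

/-- A torus point of codimension one is the zero locus of a prime Laurent polynomial. -/
lemma exists_prime_of_isTorusPoint {x : Δ.toricVariety} (hx : Order.coheight x = 1)
    (h : Δ.IsTorusPoint x) : ∃ p : ℂ[Fin n → ℤ], p ≠ 0 ∧ Δ.laurentOrd x p = 1 ∧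
      ∀ z, Order.coheight z = 1 → Δ.IsTorusPoint z → z ≠ x → Δ.laurentOrd z p = 0 := by
  obtain ⟨y, rfl⟩ := h
  have hy : y.asIdeal.height = 1 := (coheight_chart (Δ.chart Δ.torusCone) y).symm.trans hx
  obtain ⟨p, hpy, hp⟩ := Ideal.IsPrime.exists_mem_prime_of_ne_bot y.2
    (Ideal.ne_bot_of_height_eq_one hy)
  have hspan := Ideal.eq_span_singleton_of_height_eq_one hy hpy hp
  have hp0 : (p : ℂ[Fin n → ℤ]) ≠ 0 := fun h0 => hp.ne_zero (Subtype.ext h0)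
  refine ⟨p, hp0, Δ.laurentOrd_chart_of_eq_span Δ.torusCone hx hspan hp0, ?_⟩
  rintro z hz ⟨w, rfl⟩ hne
  have hw : w.asIdeal.height = 1 := (coheight_chart (Δ.chart Δ.torusCone) w).symm.trans hz
  refine Δ.laurentOrd_chart_of_notMem Δ.torusCone fun hpw => hne ?_
  rw [PrimeSpectrum.ext ((Ideal.eq_span_singleton_of_height_eq_one hw hpw hp).trans hspan.symm)]

/-- A prime Laurent polynomial defines a torus point of codimension one. -/
lemma exists_isTorusPoint_of_prime {p : ℂ[Fin n → ℤ]} (hp : Prime p) :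
    ∃ x : Δ.toricVariety, Order.coheight x = 1 ∧ Δ.IsTorusPoint x ∧ Δ.laurentOrd x p = 1 ∧
      ∀ f, ¬ p ∣ f → Δ.laurentOrd x f = 0 := by
  let q : coordRing (∅ : Finset (Fin n → ℤ)) := (torusEquiv n).symm p
  have hq : Prime q := (MulEquiv.prime_iff (torusEquiv n).symm).mpr hp
  have hprime : (Ideal.span {q}).IsPrime := (Ideal.span_singleton_prime hq.ne_zero).mpr hq
  let y : PrimeSpectrum (coordRing (∅ : Finset (Fin n → ℤ))) := ⟨Ideal.span {q}, hprime⟩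
  have hheight : (Ideal.span {q}).height = 1 := by
    have := (Δ.smooth _ Δ.zero_mem).isNoetherianRing
    have hprin : (Ideal.span {q}).IsPrincipal := ⟨q, rfl⟩
    apply le_antisymm
    · refine Ideal.height_le_one_of_isPrincipal_of_mem_minimalPrimes (Ideal.span {q}) _ ?_
      rw [Ideal.minimalPrimes_eq_subsingleton_self]
      rfl
    · rw [Order.one_le_iff_ne_zero, Ne, Ideal.height_eq_zero_iff_eq_bot,
        Ideal.span_singleton_eq_bot]
      exact hq.ne_zero
  have hx : Order.coheight (Δ.chart Δ.torusCone y) = 1 :=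
    (coheight_chart (Δ.chart Δ.torusCone) y).trans hheight
  refine ⟨_, hx, ⟨y, rfl⟩,
    Δ.laurentOrd_chart_of_eq_span Δ.torusCone hx (f := q) rfl hp.ne_zero, fun f hf => ?_⟩
  refine Δ.laurentOrd_chart_of_notMem Δ.torusCone (f := ⟨f, coordRing_empty f⟩) fun h => hf ?_
  obtain ⟨g, hg⟩ := Ideal.mem_span_singleton.mp h
  exact ⟨g, congrArg Subtype.val hg⟩

instance : Finite Δ.Ray :=
  Finite.of_injective (fun ρ => (⟨{ρ.1}, ρ.2⟩ : Δ.cones)) fun _ _ h =>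
    Subtype.ext (Finset.singleton_injective (congrArg Subtype.val h))

instance : Fintype Δ.Ray := Fintype.ofFinite _

/-- The prime divisor of a ray. -/
def rayDivisor (ρ : Δ.Ray) : PrimeDivisor Δ.toricVariety :=
  ⟨Δ.boundaryPoint ρ, Δ.coheight_boundaryPoint ρ⟩

/-- The torus-invariant divisor with given coefficients. -/
def invariantDivisor : (Δ.Ray → ℤ) →+ WeilDivisor Δ.toricVariety where
  toFun a := ∑ ρ, a ρ • Δ.toricDivisor ρ
  map_zero' := by simp
  map_add' a b := by simp [add_smul, Finset.sum_add_distrib]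

lemma invariantDivisor_apply (a : Δ.Ray → ℤ) :
    Δ.invariantDivisor a = ∑ ρ, a ρ • Δ.toricDivisor ρ := rfl

lemma invariantDivisor_rayDivisor (a : Δ.Ray → ℤ) (ρ : Δ.Ray) :
    Δ.invariantDivisor a (Δ.rayDivisor ρ) = a ρ := by
  classical
  have h : ∀ σ, Δ.toricDivisor σ (Δ.rayDivisor ρ) = if σ = ρ then 1 else 0 := by
    intro σ
    have hi : Δ.rayDivisor σ = Δ.rayDivisor ρ ↔ σ = ρ :=
      ⟨fun h => Δ.boundaryPoint_injective (congrArg Subtype.val h), fun h => h ▸ rfl⟩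
    change (Finsupp.single (Δ.rayDivisor σ) (1 : ℤ)) (Δ.rayDivisor ρ) = _
    rw [Finsupp.single_apply]
    simp only [hi]
  simp [invariantDivisor_apply, Finsupp.finsetSum_apply, h]

lemma invariantDivisor_of_isTorusPoint (a : Δ.Ray → ℤ) {x : PrimeDivisor Δ.toricVariety}
    (hx : Δ.IsTorusPoint x.1) : Δ.invariantDivisor a x = 0 := by
  rw [invariantDivisor_apply, Finsupp.finsetSum_apply]
  refine Finset.sum_eq_zero fun ρ _ => ?_
  have h : Δ.toricDivisor ρ x = 0 := Finsupp.single_eq_of_ne (a := Δ.rayDivisor ρ) ?_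
  · rw [Finsupp.smul_apply, h, smul_zero]
  rintro rfl
  exact Δ.not_isTorusPoint_boundaryPoint ρ hx

lemma exists_rayDivisor (x : PrimeDivisor Δ.toricVariety) :
    Δ.IsTorusPoint x.1 ∨ ∃ ρ, x = Δ.rayDivisor ρ :=
  (Δ.isTorusPoint_or_eq_boundaryPoint x.2).imp_right fun ⟨ρ, h⟩ => ⟨ρ, Subtype.ext h⟩

/-- The divisor of a character. -/
lemma invariantDivisor_mem_principalDivisors (m : Fin n → ℤ) :
    Δ.invariantDivisor (fun ρ => m ⬝ᵥ ρ.1) ∈ principalDivisors Δ.toricVariety := by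
  refine ⟨Δ.ratFun (monomial m), Δ.ratFun_ne_zero (monomial_ne_zero m), fun x => ?_⟩
  rcases Δ.exists_rayDivisor x with hx | ⟨ρ, rfl⟩
  · rw [Δ.invariantDivisor_of_isTorusPoint _ hx]
    exact (Δ.laurentOrd_monomial_of_isTorusPoint hx m).symm
  · rw [invariantDivisor_rayDivisor]
    exact (Δ.laurentOrd_monomial ρ m).symm

/-- A torus-invariant principal divisor is the divisor of a character. -/
lemma exists_eq_of_mem_principalDivisors {a : Δ.Ray → ℤ}
    (h : Δ.invariantDivisor a ∈ principalDivisors Δ.toricVariety) :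
    ∃ m : Fin n → ℤ, ∀ ρ, a ρ = m ⬝ᵥ ρ.1 := by
  obtain ⟨z, hz, hord⟩ := h
  obtain ⟨a', b', hb', rfl⟩ := Δ.exists_eq_ratFun_div z
  have ha' : a' ≠ 0 := by
    rintro rfl
    simp at hz
  obtain ⟨f, g, d, hrel, rfl, rfl⟩ :=
    UniqueFactorizationMonoid.exists_reduced_factors a' ha' b'
  have hf : f ≠ 0 := right_ne_zero_of_mul ha'
  have hg : g ≠ 0 := right_ne_zero_of_mul hb'
  have hd : d ≠ 0 := left_ne_zero_of_mul ha'
  have key : ∀ x : PrimeDivisor Δ.toricVariety,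
      Δ.invariantDivisor a x + Δ.laurentOrd x.1 g = Δ.laurentOrd x.1 f := by
    intro x
    have hmul : Scheme.ord (Δ.ratFun (d * f)) x.1 =
        Scheme.ord (Δ.ratFun (d * f) / Δ.ratFun (d * g)) x.1 +
          Scheme.ord (Δ.ratFun (d * g)) x.1 := by
      rw [← Scheme.ord_mul hz (Δ.ratFun_ne_zero hb'),
        div_mul_cancel₀ _ (Δ.ratFun_ne_zero hb')]
    rw [hord]
    have h1 := Δ.laurentOrd_mul x.1 hd hf
    have h2 := Δ.laurentOrd_mul x.1 hd hg
    simp only [laurentOrd] at *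
    omega
  -- An irreducible factor of `q` does not divide the coprime `r`, so along its zero locus `q` has
  -- positive order and `r` order zero. Applied both ways, this makes numerator and denominator of
  -- the reduced fraction units.
  have hunit : ∀ q r : ℂ[Fin n → ℤ], q ≠ 0 → IsRelPrime q r →
      (∀ x : PrimeDivisor Δ.toricVariety, Δ.IsTorusPoint x.1 →
        Δ.laurentOrd x.1 q = Δ.laurentOrd x.1 r) → IsUnit q := by
    intro q r hq hqr heq
    by_contra hu
    obtain ⟨p, hp, hpq⟩ := WfDvdMonoid.exists_irreducible_factor hu hq
    obtain ⟨x, hx, ht, h1, h0⟩ := Δ.exists_isTorusPoint_of_prime hp.prime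
    have hpr : ¬ p ∣ r := fun h => hp.not_isUnit (hqr hpq h)
    obtain ⟨t, rfl⟩ := hpq
    have ht0 : t ≠ 0 := right_ne_zero_of_mul hq
    have h2 : Δ.laurentOrd x (p * t) = Δ.laurentOrd x r := heq ⟨x, hx⟩ ht
    rw [h0 r hpr, Δ.laurentOrd_mul _ hp.ne_zero ht0, h1] at h2
    have h3 := Δ.laurentOrd_nonneg ht t
    omega
  have hfg : ∀ x : PrimeDivisor Δ.toricVariety, Δ.IsTorusPoint x.1 →
      Δ.laurentOrd x.1 f = Δ.laurentOrd x.1 g := fun x hx => by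
    rw [← key x, Δ.invariantDivisor_of_isTorusPoint a hx, zero_add]
  obtain ⟨c, hc, m, hfm⟩ := exists_eq_smul_monomial_of_isUnit (hunit f g hf hrel hfg)
  obtain ⟨c', hc', m', hgm⟩ := exists_eq_smul_monomial_of_isUnit
    (hunit g f hg hrel.symm fun x hx => (hfg x hx).symm)
  refine ⟨m - m', fun ρ => ?_⟩
  -- Scalars do not change the order: `laurentOrd_le` bounds it above, and the same bound for the
  -- constant `c⁻¹` gives the reverse inequality.
  have hsmul : ∀ (c : ℂ), c ≠ 0 → ∀ m : Fin n → ℤ,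
      Δ.laurentOrd (Δ.boundaryPoint ρ) (c • monomial m) = m ⬝ᵥ ρ.1 := by
    intro c hc m
    apply le_antisymm
    · exact Δ.laurentOrd_le ρ (by simp [monomial, hc])
    · have h1 := Δ.laurentOrd_mul (Δ.boundaryPoint ρ) (f := c • monomial m) (g := c⁻¹ • 1)
        (smul_ne_zero hc (monomial_ne_zero m)) (smul_ne_zero (inv_ne_zero hc) one_ne_zero)
      rw [smul_mul_smul_comm, mul_inv_cancel₀ hc, one_smul, mul_one, laurentOrd_monomial] at h1
      have h2 := Δ.laurentOrd_le ρ (f := c⁻¹ • 1) (m := 0)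
        (by rw [← monomial_zero]; simp [monomial, hc])
      rw [zero_dotProduct] at h2
      omega
  have h := key (Δ.rayDivisor ρ)
  rw [invariantDivisor_rayDivisor] at h
  change _ + Δ.laurentOrd (Δ.boundaryPoint ρ) _ = Δ.laurentOrd (Δ.boundaryPoint ρ) _ at h
  rw [hfm, hgm, hsmul c hc, hsmul c' hc'] at h
  rw [sub_dotProduct]
  omega

/-- Every prime divisor is linearly equivalent to an effective torus-invariant divisor. -/
lemma exists_toClass_single_eq (x : PrimeDivisor Δ.toricVariety) :
    ∃ a : Δ.Ray → ℤ, 0 ≤ a ∧ WeilDivisor.toClass (Finsupp.single x 1 : WeilDivisor Δ.toricVariety) =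
      (Δ.invariantDivisor a).toClass := by
  classical
  rcases Δ.exists_rayDivisor x with hx | ⟨ρ, rfl⟩
  · obtain ⟨p, hp0, hpx, hpz⟩ := Δ.exists_prime_of_isTorusPoint x.2 hx
    obtain ⟨m, hm⟩ : p.coeff.support.Nonempty := by
      rw [Finsupp.support_nonempty_iff]
      exact fun h => hp0 (AddMonoidAlgebra.coeff_injective h)
    -- On the torus `p` cuts out exactly `x`. Dividing it by a character from its own support makes
    -- all boundary orders nonpositive, so moving the boundary part across gives an effective
    -- divisor.
    refine ⟨fun ρ => m ⬝ᵥ ρ.1 - Δ.laurentOrd (Δ.boundaryPoint ρ) p,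
      fun ρ => sub_nonneg.mpr (Δ.laurentOrd_le ρ hm), ?_⟩
    refine (QuotientAddGroup.eq_iff_sub_mem).mpr
      ⟨Δ.ratFun (monomial (-m) * p), Δ.ratFun_ne_zero (mul_ne_zero (monomial_ne_zero _) hp0),
        fun z => ?_⟩
    change _ = Δ.laurentOrd z.1 _
    rw [Finsupp.sub_apply, laurentOrd_mul _ _ (monomial_ne_zero _) hp0]
    rcases Δ.exists_rayDivisor z with hz | ⟨ρ, rfl⟩
    · rw [Δ.invariantDivisor_of_isTorusPoint _ hz, Δ.laurentOrd_monomial_of_isTorusPoint hz]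
      by_cases hzx : z = x
      · rw [hzx, Finsupp.single_eq_same, hpx]
        rfl
      · rw [Finsupp.single_eq_of_ne hzx, hpz z.1 z.2 hz fun h => hzx (Subtype.ext h)]
        rfl
    · rw [invariantDivisor_rayDivisor, Finsupp.single_eq_of_ne]
      · change _ = Δ.laurentOrd (Δ.boundaryPoint ρ) _ + Δ.laurentOrd (Δ.boundaryPoint ρ) _
        rw [laurentOrd_monomial, neg_dotProduct]
        ring
      · rintro rfl
        exact Δ.not_isTorusPoint_boundaryPoint ρ hx
  · refine ⟨Pi.single ρ 1, Pi.single_nonneg.mpr zero_le_one, congrArg _ ?_⟩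
    simp [invariantDivisor_apply, Pi.single_apply]
    rfl

/-- Every divisor is linearly equivalent to a torus-invariant divisor, which can be chosen effective
if the divisor is. -/
lemma exists_toClass_eq (D : WeilDivisor Δ.toricVariety) :
    ∃ a : Δ.Ray → ℤ, (0 ≤ D → 0 ≤ a) ∧ D.toClass = (Δ.invariantDivisor a).toClass := by
  choose b hb0 hb using Δ.exists_toClass_single_eq
  refine ⟨∑ x ∈ D.support, D x • b x,
    fun hD => Finset.sum_nonneg fun x _ => smul_nonneg (hD x) (hb0 x), ?_⟩
  let π : WeilDivisor Δ.toricVariety →+ DivisorClassGroup Δ.toricVariety :=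
    QuotientAddGroup.mk' _
  have hπ : ∀ E : WeilDivisor Δ.toricVariety, E.toClass = π E := fun _ => rfl
  simp only [hπ] at hb ⊢
  conv_lhs => rw [← Finsupp.sum_single D, Finsupp.sum, map_sum]
  rw [map_sum, map_sum]
  refine Finset.sum_congr rfl fun x _ => ?_
  rw [map_zsmul, map_zsmul, ← hb, ← map_zsmul, Finsupp.smul_single_one]

end SmoothFan

/-! ### Consequences of completeness, and the effective cone. -/

namespace SmoothFan

variable {n : ℕ} {Δ : SmoothFan n}

/-- The primitive generator of a ray as a real vector. -/
def Ray.toReal (ρ : Δ.Ray) : Fin n → ℝ := fun i => (ρ.1 i : ℝ)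

lemma Ray.dotProduct_toReal (ρ : Δ.Ray) (m : Fin n → ℤ) :
    (fun i => (m i : ℝ)) ⬝ᵥ ρ.toReal = ((m ⬝ᵥ ρ.1 : ℤ) : ℝ) := by
  simp [dotProduct, Ray.toReal]

lemma exists_ray_of_mem {s : Finset (Fin n → ℤ)} (hs : s ∈ Δ.cones) {u : Fin n → ℤ} (hu : u ∈ s) :
    ∃ ρ : Δ.Ray, ρ.1 = u :=
  ⟨⟨u, Δ.face_mem _ hs _ (Finset.singleton_subset_iff.mpr hu)⟩, rfl⟩

lemma IsComplete.exists_eq_sum (hΔ : Δ.IsComplete) (v : Fin n → ℝ) :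
    ∃ c : Δ.Ray → ℝ, 0 ≤ c ∧ v = ∑ ρ, c ρ • ρ.toReal := by
  classical
  obtain ⟨s, hs, hv⟩ := hΔ v
  induction hv using Submodule.span_induction with
  | mem x hx =>
    obtain ⟨u, hu, rfl⟩ := hx
    obtain ⟨ρ, rfl⟩ := exists_ray_of_mem hs hu
    exact ⟨Pi.single ρ 1, Pi.single_nonneg.mpr zero_le_one, by simp [Pi.single_apply]; rfl⟩
  | zero => exact ⟨0, le_rfl, by simp⟩
  | add x y _ _ hx hy =>
    obtain ⟨c, hc, rfl⟩ := hx
    obtain ⟨d, hd, rfl⟩ := hy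
    exact ⟨c + d, add_nonneg hc hd, by simp [add_smul, Finset.sum_add_distrib]⟩
  | smul r x _ hx =>
    obtain ⟨c, hc, rfl⟩ := hx
    refine ⟨(r : ℝ) • c, smul_nonneg r.2 hc, ?_⟩
    rw [Finset.smul_sum]
    exact Finset.sum_congr rfl fun ρ _ => smul_smul (r : ℝ) (c ρ) ρ.toReal

/-- The primitive generators of the rays of a complete fan satisfy a positive linear relation. -/
lemma IsComplete.exists_pos_relation (hΔ : Δ.IsComplete) :
    ∃ b : Δ.Ray → ℝ, (∀ ρ, 0 < b ρ) ∧ ∑ ρ, b ρ • ρ.toReal = 0 := by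
  classical
  choose c hc0 hc using fun ρ : Δ.Ray => hΔ.exists_eq_sum (-ρ.toReal)
  -- Adding up the relations `u_σ + ∑ c_σρ u_ρ = 0` over all `σ`, each generator contributes once by
  -- itself; hence the positive summand `1`.
  refine ⟨1 + ∑ σ, c σ, fun ρ => ?_, ?_⟩
  · rw [Pi.add_apply, Finset.sum_apply]
    exact add_pos_of_pos_of_nonneg one_pos (Finset.sum_nonneg fun σ _ => hc0 σ ρ)
  · simp only [Pi.add_apply, Pi.one_apply, Finset.sum_apply, add_smul, one_smul,
      Finset.sum_add_distrib, Finset.sum_smul]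
    rw [Finset.sum_comm, ← Finset.sum_add_distrib]
    exact Finset.sum_eq_zero fun ρ _ => by rw [← hc ρ, add_neg_cancel]

/-- Without rays the all-ones vector would be an empty sum. -/
lemma IsComplete.nonempty_ray (hΔ : Δ.IsComplete) (hn : 0 < n) : Nonempty Δ.Ray := by
  by_contra h
  rw [not_nonempty_iff] at h
  obtain ⟨c, -, hc⟩ := hΔ.exists_eq_sum 1
  simpa using congrFun hc ⟨0, hn⟩

/-- A complete smooth fan contains a cone whose primitive generators form a lattice basis. -/
lemma IsComplete.exists_basis (hΔ : Δ.IsComplete) :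
    ∃ b : Module.Basis (Fin n) ℤ (Fin n → ℤ), ∃ s ∈ Δ.cones, ∀ i, b i ∈ s := by
  have hcover : ⋃ s : Δ.cones, ((Submodule.span ℝ
      ((fun u i => (u i : ℝ)) '' (s.1 : Set (Fin n → ℤ))) : Subspace ℝ (Fin n → ℝ)) :
        Set (Fin n → ℝ)) = Set.univ := by
    refine Set.eq_univ_of_forall fun v => ?_
    obtain ⟨s, hs, hv⟩ := hΔ v
    refine Set.mem_iUnion.mpr ⟨⟨s, hs⟩, ?_⟩
    exact Submodule.span_le_restrictScalars {c : ℝ // 0 ≤ c} ℝ _ hv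
  -- A real vector space is not a finite union of proper subspaces, so some cone spans `ℝⁿ`. Were a
  -- basis vector missing from it, the dual coordinate would vanish on that span.
  obtain ⟨⟨s, hs⟩, htop⟩ := Subspace.exists_eq_top_of_iUnion_eq_univ hcover
  obtain ⟨b, hb⟩ := Δ.smooth s hs
  refine ⟨b, s, hs, fun i => ?_⟩
  by_contra his
  obtain ⟨e, he⟩ := IsPartOfBasis.exists_dual (s := Finset.univ.image b) ⟨b, by simp⟩
    (fun u => if u = b i then 1 else 0)
  have hle : Submodule.span ℝ ((fun u i => (u i : ℝ)) '' (s : Set (Fin n → ℤ))) ≤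
      LinearMap.ker (dotProductBilin ℝ ℝ (fun i => (e i : ℝ))) := by
    rw [Submodule.span_le]
    rintro _ ⟨u, hu, rfl⟩
    obtain ⟨j, rfl⟩ := hb hu
    have h1 := he (b j) (by simp)
    have hne : b j ≠ b i := fun h => his (by rw [← h]; exact hu)
    rw [if_neg hne] at h1
    have h2 : ((e ⬝ᵥ b j : ℤ) : ℝ) = 0 := by rw [h1, Int.cast_zero]
    simpa [dotProduct] using h2
  have h3 : (fun k => (b i k : ℝ)) ∈
      LinearMap.ker (dotProductBilin ℝ ℝ (fun i => (e i : ℝ))) :=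
    hle (htop ▸ Submodule.mem_top)
  have h4 : ((e ⬝ᵥ b i : ℤ) : ℝ) = 0 := by simpa [dotProduct] using h3
  rw [he (b i) (by simp), if_pos rfl] at h4
  simp at h4

/-- The divisor class group of a smooth complete toric variety is torsion free. -/
lemma IsComplete.isTorsionFree (hΔ : Δ.IsComplete) :
    Module.IsTorsionFree ℤ (DivisorClassGroup Δ.toricVariety) := by
  have key : ∀ (k : ℤ), k ≠ 0 → ∀ x : DivisorClassGroup Δ.toricVariety, k • x = 0 → x = 0 := by
    intro k hk x hx
    obtain ⟨D, rfl⟩ := QuotientAddGroup.mk_surjective x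
    obtain ⟨a, -, ha⟩ := Δ.exists_toClass_eq D
    change WeilDivisor.toClass D = 0
    change k • WeilDivisor.toClass D = 0 at hx
    rw [ha] at hx ⊢
    have hk' : Δ.invariantDivisor (k • a) ∈ principalDivisors Δ.toricVariety := by
      rw [map_zsmul]
      exact (QuotientAddGroup.eq_zero_iff _).mp hx
    obtain ⟨m, hm⟩ := Δ.exists_eq_of_mem_principalDivisors hk'
    obtain ⟨b, s, hs, hb⟩ := hΔ.exists_basis
    -- The integer division is exact on the generators of `s`, where `m ⬝ᵥ u` is `k` times a
    -- coefficient of `a`. As `s` contains a basis, `m` itself is divisible by `k`.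
    obtain ⟨m', hm'⟩ := (Δ.smooth s hs).exists_dual (fun u => (m ⬝ᵥ u) / k)
    have hmm : m = k • m' := by
      refine dotProduct_eq _ _ fun v => ?_
      have hbi : ∀ i, m ⬝ᵥ b i = (k • m') ⬝ᵥ b i := fun i => by
        obtain ⟨ρ, hρ⟩ := exists_ray_of_mem hs (hb i)
        have hdvd : k ∣ m ⬝ᵥ b i := ⟨a ρ, by rw [← hρ, ← hm ρ]; rfl⟩
        rw [smul_dotProduct, hm' _ (hb i), smul_eq_mul, Int.mul_ediv_cancel' hdvd]
      rw [← b.sum_repr v, dotProduct_sum, dotProduct_sum]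
      exact Finset.sum_congr rfl fun i _ => by rw [dotProduct_smul, dotProduct_smul, hbi i]
    have ham : a = fun ρ => m' ⬝ᵥ ρ.1 := by
      funext ρ
      have := hm ρ
      rw [hmm, smul_dotProduct] at this
      exact mul_left_cancel₀ hk this
    rw [ham]
    exact (QuotientAddGroup.eq_zero_iff _).mpr (Δ.invariantDivisor_mem_principalDivisors m')
  refine ⟨fun k hk x y hxy => sub_eq_zero.mp (key k hk.ne_zero _ ?_)⟩
  exact (zsmul_sub x y k).trans (sub_eq_zero.mpr hxy)

/-- A linear form on the divisor class group that is positive on the torus-invariant prime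
divisors. -/
lemma IsComplete.exists_degree (hΔ : Δ.IsComplete) :
    ∃ deg : DivisorClassGroup Δ.toricVariety →+ ℝ, ∀ ρ, 0 < deg (Δ.toricDivisor ρ).toClass := by
  classical
  obtain ⟨b, hb, hrel⟩ := hΔ.exists_pos_relation
  let F : (Δ.Ray → ℤ) →+ DivisorClassGroup Δ.toricVariety :=
    (QuotientAddGroup.mk' _).comp Δ.invariantDivisor
  have hF : Function.Surjective F := by
    intro x
    obtain ⟨D, rfl⟩ := QuotientAddGroup.mk_surjective x
    obtain ⟨a, -, ha⟩ := Δ.exists_toClass_eq D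
    exact ⟨a, ha.symm⟩
  let G : (Δ.Ray → ℤ) →+ ℝ := AddMonoidHom.mk' (fun a => ∑ ρ, b ρ * a ρ) fun a a' => by
    simp [mul_add, Finset.sum_add_distrib]
  -- Pairing the positive relation with `m` shows that `G` vanishes on the divisor of the character
  -- of `m`.
  have hker : F.ker ≤ G.ker := by
    intro a ha
    obtain ⟨m, hm⟩ := Δ.exists_eq_of_mem_principalDivisors ((QuotientAddGroup.eq_zero_iff _).mp ha)
    have h := congrArg (fun v => (fun i => (m i : ℝ)) ⬝ᵥ v) hrel
    simp only [dotProduct_sum, dotProduct_smul, Ray.dotProduct_toReal, dotProduct_zero,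
      smul_eq_mul, ← hm] at h
    exact h
  refine ⟨F.liftOfSurjective hF ⟨G, hker⟩, fun ρ => ?_⟩
  have h1 : (Δ.toricDivisor ρ).toClass = F (Pi.single ρ 1) := by
    refine congrArg (QuotientAddGroup.mk' (principalDivisors _)) ?_
    simp [invariantDivisor_apply, Pi.single_apply]
  rw [h1, AddMonoidHom.liftOfRightInverse_comp_apply]
  simpa [G, Pi.single_apply] using hb ρ

/-- The effective cone is generated by the classes of the torus-invariant prime divisors. -/
lemma exists_eq_sum_of_mem_effectiveCone {x : ℝ ⊗[ℤ] DivisorClassGroup Δ.toricVariety}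
    (hx : x ∈ effectiveCone Δ.toricVariety) :
    ∃ t : Δ.Ray → ℝ, 0 ≤ t ∧ x = ∑ ρ, t ρ • ((1 : ℝ) ⊗ₜ[ℤ] (Δ.toricDivisor ρ).toClass) := by
  induction hx using Submodule.span_induction with
  | mem x hx =>
    obtain ⟨D, hD, rfl⟩ := hx
    obtain ⟨a, ha0, ha⟩ := Δ.exists_toClass_eq D
    refine ⟨fun ρ => a ρ, fun ρ => Int.cast_nonneg (ha0 hD ρ), ?_⟩
    have h1 : (Δ.invariantDivisor a).toClass = ∑ ρ, a ρ • (Δ.toricDivisor ρ).toClass := by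
      change QuotientAddGroup.mk' (principalDivisors _) _ = _
      rw [invariantDivisor_apply, map_sum]
      exact Finset.sum_congr rfl fun ρ _ => map_zsmul _ _ _
    rw [ha, h1, TensorProduct.tmul_sum]
    refine Finset.sum_congr rfl fun ρ _ => ?_
    rw [TensorProduct.tmul_smul, Int.cast_smul_eq_zsmul]
  | zero => exact ⟨0, le_rfl, by simp⟩
  | add x y _ _ hx hy =>
    obtain ⟨c, hc, rfl⟩ := hx
    obtain ⟨d, hd, rfl⟩ := hy
    exact ⟨c + d, add_nonneg hc hd, by simp [add_smul, Finset.sum_add_distrib]⟩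
  | smul r x _ hx =>
    obtain ⟨c, hc, rfl⟩ := hx
    refine ⟨(r : ℝ) • c, smul_nonneg r.2 hc, ?_⟩
    refine (Finset.smul_sum (r := (r : ℝ))).trans ?_
    exact Finset.sum_congr rfl fun ρ _ => smul_smul (r : ℝ) (c ρ) _

/-- A linear form positive on the torus-invariant prime divisors is positive on the nonzero elements
of the effective cone. -/
lemma eq_zero_of_mem_effectiveCone {deg : DivisorClassGroup Δ.toricVariety →+ ℝ}
    (hdeg : ∀ ρ, 0 < deg (Δ.toricDivisor ρ).toClass) {x : DivisorClassGroup Δ.toricVariety}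
    (hx : (1 : ℝ) ⊗ₜ[ℤ] x ∈ effectiveCone Δ.toricVariety) (h : deg x ≤ 0) :
    (1 : ℝ) ⊗ₜ[ℤ] x = 0 := by
  obtain ⟨t, ht, hxt⟩ := exists_eq_sum_of_mem_effectiveCone hx
  have hd := congrArg (deg.toIntLinearMap.liftBaseChange ℝ) hxt
  simp only [map_sum, map_smul, LinearMap.liftBaseChange_tmul, smul_eq_mul, one_mul,
    AddMonoidHom.coe_toIntLinearMap] at hd
  have hnn : ∀ ρ ∈ Finset.univ, 0 ≤ t ρ * deg (Δ.toricDivisor ρ).toClass := fun ρ _ =>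
    mul_nonneg (ht ρ) (hdeg ρ).le
  -- A sum of nonnegative terms that is at most zero has only zero terms; as the degrees are
  -- positive, every `t ρ` vanishes.
  have h0 := (Finset.sum_eq_zero_iff_of_nonneg hnn).mp
    (le_antisymm (hd.symm.trans_le h) (Finset.sum_nonneg hnn))
  rw [hxt]
  refine Finset.sum_eq_zero fun ρ hρ => ?_
  rw [(mul_eq_zero.mp (h0 ρ hρ)).resolve_right (hdeg ρ).ne', zero_smul]

end SmoothFan

/-- Torsion-free abelian groups are flat, so tensoring `ℤ → ℝ` with `A` stays injective. -/
lemma eq_zero_of_one_tmul_eq_zero {A : Type*} [AddCommGroup A] [Module.IsTorsionFree ℤ A] {x : A}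
    (h : (1 : ℝ) ⊗ₜ[ℤ] x = 0) : x = 0 := by
  have hinj := Module.Flat.rTensor_preserves_injective_linearMap (M := A)
    (Algebra.linearMap ℤ ℝ) Int.cast_injective
  have h1 : (1 : ℤ) ⊗ₜ[ℤ] x = 0 := hinj (by simpa using h)
  simpa using congrArg (TensorProduct.lid ℤ A) h1

end Toric

end

theorem mainTheorem6 (n : ℕ) (hn : 0 < n) (Δ : Toric.SmoothFan n) (hΔ : Δ.IsComplete) :
    ∃ ρ₀ : Δ.Ray, ∀ ρ : Δ.Ray,
      (Δ.toricDivisor ρ).toClass = (Δ.toricDivisor ρ₀).toClass ∨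
      (1 : ℝ) ⊗ₜ[ℤ] ((Δ.toricDivisor ρ).toClass - (Δ.toricDivisor ρ₀).toClass) ∉
        Toric.effectiveCone Δ.toricVariety := by
  obtain ⟨deg, hdeg⟩ := hΔ.exists_degree
  have := hΔ.nonempty_ray hn
  have := hΔ.isTorsionFree
  -- A ray of largest degree: differences with the other rays then have degree at most zero.
  obtain ⟨ρ₀, hρ₀⟩ := Finite.exists_max fun ρ => deg (Δ.toricDivisor ρ).toClass
  refine ⟨ρ₀, fun ρ => or_iff_not_imp_right.mpr fun h => sub_eq_zero.mp ?_⟩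
  refine Toric.eq_zero_of_one_tmul_eq_zero
    (Toric.SmoothFan.eq_zero_of_mem_effectiveCone hdeg (not_not.mp h) ?_)
  rw [map_sub, sub_nonpos]
  exact hρ₀ ρ
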